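/- Let $\mathbb T^d$, $d\in\mathbb N=\{1,2,\dots\}$, be the $d$-dimensional torus $[0,2\pi]^d$ (opposite faces identified) with the normalized Lebesgue measure, let $\widehat f(k)$, $k\in\mathbb Z^d$, be the Fourier coefficients of $f$ with respect to $e^{ikx}$, and for $s>0$ let $H^{s,2}_{\rm mix}(\mathbb T^d)$ be the space of all (complex-valued) $f\in L_2(\mathbb T^d)$ with $$\|f\,|\,H^{s,2}_{\rm mix}(\mathbb T^d)\|=\Big(\sum_{k\in\mathbb Z^d}\prod_{j=1}^d(1+|k_j|^2)^{s}\,|\widehat f(k)|^2\Big)^{1/2}<\infty .$$ For a bounded linear operator $T:X\to Y$ between Banach spaces and $n\in\mathbb N$ let $a_n(T)=\inf\{\|T-A\| : A:X\to Y \text{ bounded linear},\ \operatorname{rank}A<n\}$ be its $n$-th approximation number. For $s>1/2$ the identity $I_d: f\mapsto f$ is a bounded linear operator from $H^{s,2}_{\rm mix}(\mathbb T^d)$ into $L_\infty(\mathbb T^d)$. Let $d\in\mathbb N$ and $s>1/2$. Then $$a_n\big(I_d:H^{s,2}_{\rm mix}(\mathbb T^d)\to L_\infty(\mathbb T^d)\big)\le\sqrt{\frac{2}{2s-1}}\left[\frac{(3\sqrt2)^d}{(d-1)!}\right]^s\frac{(\ln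 n)^{(d-1)s}}{n^{s-1/2}}$$ for all $n\in\mathbb N$ with $n>\max\big(27^d,e^{4(d-1)s/(2s-1)}\big)$, and $$a_n\big(I_d:H^{s,2}_{\rm mix}(\mathbb T^d)\to L_\infty(\mathbb T^d)\big)\ge\sqrt{\frac{1}{4s-2}}\left[\frac{5}{6\,d!\,(1+\ln\sqrt{12})^d}\right]^s\frac{(\ln(2n))^{(d-1)s}}{n^{s-1/2}}$$ for all $n\in\mathbb N$ with $n>(12e^2)^d$. -/

import Mathlib

open MeasureTheory UnitAddTorus
open scoped ENNReal Nat

/-- The circle `ℝ / ℤ` carries its normalized Haar measure (total mass one). This is the measure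
that Mathlib uses in its theory of Fourier series on `UnitAddTorus`. -/
noncomputable local instance instMeasureSpaceCircle : MeasureSpace UnitAddCircle :=
  ⟨AddCircle.haarAddCircle⟩

noncomputable local instance instIsAddHaarMeasureCircle :
    Measure.IsAddHaarMeasure (volume : Measure UnitAddCircle) :=
  inferInstanceAs (Measure.IsAddHaarMeasure AddCircle.haarAddCircle)

noncomputable local instance instIsProbabilityMeasureCircle :
    IsProbabilityMeasure (volume : Measure UnitAddCircle) :=
  inferInstanceAs (IsProbabilityMeasure AddCircle.haarAddCircle)

/-- The `d`-dimensional torus, with the circle written as `ℝ / ℤ`: the characters are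
`mFourier k x = exp (2πi k·x)`, and the measure is the normalized product measure. -/
abbrev Torus (d : ℕ) : Type := UnitAddTorus (Fin d)

/-- The complex space `L_p` of the torus with its normalized measure. -/
abbrev TorusLp (d : ℕ) (p : ℝ≥0∞) : Type := Lp ℂ p (volume : Measure (Torus d))

/-- The `n`-th approximation number of a bounded linear operator: the infimum of `‖T - A‖` over all
bounded linear operators `A` of rank less than `n`. -/
noncomputable def approxNumber {X Y : Type*} [NormedAddCommGroup X] [NormedSpace ℂ X]
    [NormedAddCommGroup Y] [NormedSpace ℂ Y] (T : X →L[ℂ] Y) (n : ℕ) : ℝ :=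
  sInf {ε : ℝ | ∃ A : X →L[ℂ] Y, LinearMap.rank (A : X →ₗ[ℂ] Y) < (n : Cardinal) ∧ ε = ‖T - A‖}

/-- The weight `∏ j, (1 + |k_j| ^ r) ^ (s / r)` of dominating mixed smoothness `s`. -/
noncomputable def mixWeight {d : ℕ} (s r : ℝ) (k : Fin d → ℤ) : ℝ :=
  ∏ j, (1 + |(k j : ℝ)| ^ r) ^ (s / r)

theorem mixWeight_pos {d : ℕ} (s r : ℝ) (k : Fin d → ℤ) : 0 < mixWeight s r k :=
  Finset.prod_pos fun _ _ => by positivity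

theorem torusCoeff_add {d : ℕ} (f g : TorusLp d 2) (k : Fin d → ℤ) :
    mFourierCoeff (⇑(f + g)) k = mFourierCoeff f k + mFourierCoeff g k := by
  simp only [← mFourierBasis_repr, map_add]; rfl

theorem torusCoeff_smul {d : ℕ} (c : ℂ) (f : TorusLp d 2) (k : Fin d → ℤ) :
    mFourierCoeff (⇑(c • f)) k = c * mFourierCoeff f k := by
  simp only [← mFourierBasis_repr, map_smul]; rfl

theorem memℓp_mix_iff {d : ℕ} (s r : ℝ) (f : TorusLp d 2) :
    Memℓp (fun k : Fin d → ℤ => (mixWeight s r k : ℂ) * mFourierCoeff f k) 2 ↔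
      Summable fun k : Fin d → ℤ => mixWeight s r k ^ 2 * ‖mFourierCoeff f k‖ ^ 2 := by
  rw [memℓp_gen_iff (by norm_num)]
  refine summable_congr fun k => ?_
  simp [abs_of_pos (mixWeight_pos s r k), mul_pow]

/-- The functions in `L_2` of the torus whose weighted Fourier coefficients are square summable,
as a linear subspace of `L_2`. -/
noncomputable def mixSubmodule (d : ℕ) (s r : ℝ) : Submodule ℂ (TorusLp d 2) where
  carrier := {f | Summable fun k : Fin d → ℤ => mixWeight s r k ^ 2 * ‖mFourierCoeff f k‖ ^ 2}
  zero_mem' := by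
    have h : ∀ k : Fin d → ℤ, mFourierCoeff (⇑(0 : TorusLp d 2)) k = 0 := fun k => by
      simp only [← mFourierBasis_repr, map_zero]; rfl
    simp only [Set.mem_ofPred_eq, h]
    simp
  add_mem' := by
    intro f g hf hg
    simp only [Set.mem_ofPred_eq, ← memℓp_mix_iff] at hf hg ⊢
    convert hf.add hg using 1
    funext k
    simp only [torusCoeff_add, mul_add, Pi.add_apply]
  smul_mem' := by
    intro c f hf
    simp only [Set.mem_ofPred_eq, ← memℓp_mix_iff] at hf ⊢
    convert hf.const_smul c using 1
    funext k
    simp only [torusCoeff_smul, Pi.smul_apply, smul_eq_mul]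
    ring

/-- The Sobolev space `H^{s,r}_mix` of dominating mixed smoothness on the torus. It is a copy of
`mixSubmodule d s r` that does not inherit the `L_2` norm; its own norm is given below. -/
def SobolevMix (d : ℕ) (s r : ℝ) : Type := ↥(mixSubmodule d s r)

noncomputable instance (d : ℕ) (s r : ℝ) : AddCommGroup (SobolevMix d s r) :=
  inferInstanceAs (AddCommGroup ↥(mixSubmodule d s r))

noncomputable instance (d : ℕ) (s r : ℝ) : Module ℂ (SobolevMix d s r) :=
  inferInstanceAs (Module ℂ ↥(mixSubmodule d s r))

/-- The inclusion of `H^{s,r}_mix` into `L_2`. -/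
noncomputable def SobolevMix.toL2 {d : ℕ} {s r : ℝ} : SobolevMix d s r →ₗ[ℂ] TorusLp d 2 :=
  (mixSubmodule d s r).subtype

/-- The linear map which sends `f` to its weighted Fourier coefficients in `ℓ_2(ℤ^d)`. -/
noncomputable def SobolevMix.toEll2 (d : ℕ) (s r : ℝ) :
    SobolevMix d s r →ₗ[ℂ] lp (fun _ : Fin d → ℤ => ℂ) 2 where
  toFun f := ⟨fun k => (mixWeight s r k : ℂ) * mFourierCoeff (SobolevMix.toL2 f) k,
    (memℓp_mix_iff s r _).2 f.2⟩
  map_add' f g := by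
    ext k
    simp only [map_add, torusCoeff_add, mul_add, lp.coeFn_add, Pi.add_apply]
  map_smul' c f := by
    ext k
    simp only [map_smul, torusCoeff_smul, lp.coeFn_smul, Pi.smul_apply, smul_eq_mul,
      RingHom.id_apply]
    ring

theorem SobolevMix.toEll2_injective (d : ℕ) (s r : ℝ) :
    Function.Injective (SobolevMix.toEll2 d s r) := by
  intro f g h
  apply Subtype.ext
  apply (mFourierBasis (d := Fin d)).repr.injective
  ext k
  have hk := congrArg (fun u : lp (fun _ : Fin d → ℤ => ℂ) 2 => u k) h
  rw [mFourierBasis_repr, mFourierBasis_repr]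
  exact mul_left_cancel₀ (Complex.ofReal_ne_zero.2 (mixWeight_pos s r k).ne') hk

/-- The norm of `H^{s,r}_mix` is the `ℓ_2` norm of the weighted Fourier coefficients
(see `SobolevMix.norm_eq` for the explicit formula). -/
noncomputable instance (d : ℕ) (s r : ℝ) : NormedAddCommGroup (SobolevMix d s r) :=
  NormedAddCommGroup.induced _ _ (SobolevMix.toEll2 d s r) (SobolevMix.toEll2_injective d s r)

noncomputable instance (d : ℕ) (s r : ℝ) : NormedSpace ℂ (SobolevMix d s r) :=
  NormedSpace.induced ℂ (SobolevMix d s r) (lp (fun _ : Fin d → ℤ => ℂ) 2)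
    (SobolevMix.toEll2 d s r)

theorem SobolevMix.norm_eq {d : ℕ} {s r : ℝ} (f : SobolevMix d s r) :
    ‖f‖ = √(∑' k : Fin d → ℤ, mixWeight s r k ^ 2 * ‖mFourierCoeff (SobolevMix.toL2 f) k‖ ^ 2) := by
  have h : ‖f‖ = ‖SobolevMix.toEll2 d s r f‖ := rfl
  rw [h, lp.norm_eq_tsum_rpow (by norm_num), Real.sqrt_eq_rpow]
  simp [SobolevMix.toEll2, abs_of_pos (mixWeight_pos s r _), mul_pow]

/-- Products of a summable nonnegative family are summable over `ℤ^d`. -/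
theorem summable_prod_fin {f : ℤ → ℝ} (hf : Summable f) (h0 : ∀ m, 0 ≤ f m) (d : ℕ) :
    Summable fun k : Fin d → ℤ => ∏ j, f (k j) := by
  induction d with
  | zero => exact (hasSum_fintype _).summable
  | succ d ih =>
    have h := hf.mul_of_nonneg ih h0 (fun k => Finset.prod_nonneg fun _ _ => h0 _)
    rw [← (Fin.consEquiv fun _ : Fin (d + 1) => ℤ).summable_iff]
    refine h.congr fun p => ?_
    simp [Fin.consEquiv, Fin.prod_univ_succ]

theorem summable_mixWeight (d : ℕ) {s r : ℝ} (hr : 0 < r) (hs : 1 / 2 < s) :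
    Summable fun k : Fin d → ℤ => (mixWeight s r k)⁻¹ ^ 2 := by
  have h1 : Summable fun m : ℤ => ((1 + |(m : ℝ)| ^ r) ^ (s / r))⁻¹ ^ 2 := by
    refine Summable.of_norm_bounded_eventually
      (Real.summable_abs_int_rpow (b := 2 * s) (by linarith)) ?_
    refine (Set.finite_singleton (0 : ℤ)).subset fun m hm => ?_
    by_contra h0
    apply hm
    have hpos : 0 < |(m : ℝ)| := abs_pos.2 (by exact_mod_cast h0)
    show ‖_‖ ≤ _
    rw [Real.norm_of_nonneg (by positivity), inv_pow, Real.rpow_neg hpos.le]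
    apply inv_anti₀ (by positivity)
    rw [← Real.rpow_natCast, ← Real.rpow_mul (by positivity)]
    calc |(m : ℝ)| ^ (2 * s) = (|(m : ℝ)| ^ r) ^ (s / r * (2 : ℕ)) := by
          rw [← Real.rpow_mul hpos.le]; congr 1; push_cast; field_simp
      _ ≤ (1 + |(m : ℝ)| ^ r) ^ (s / r * (2 : ℕ)) := by
          apply Real.rpow_le_rpow (by positivity) (by linarith) (by positivity)
  refine (summable_prod_fin h1 (fun m => by positivity) d).congr fun k => ?_
  simp [mixWeight, Finset.prod_pow]

/-- Cauchy-Schwarz: the Fourier coefficients of `f` are absolutely summable for `s > 1/2`. -/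
theorem SobolevMix.summable_coeff {d : ℕ} {s r : ℝ} (hr : 0 < r) (hs : 1 / 2 < s)
    (f : SobolevMix d s r) :
    (Summable fun k : Fin d → ℤ => ‖mFourierCoeff (SobolevMix.toL2 f) k‖) ∧
      ∑' k : Fin d → ℤ, ‖mFourierCoeff (SobolevMix.toL2 f) k‖ ≤
        √(∑' k : Fin d → ℤ, (mixWeight s r k)⁻¹ ^ 2) * ‖f‖ := by
  have hf : Summable fun k : Fin d → ℤ =>
      (mixWeight s r k * ‖mFourierCoeff (SobolevMix.toL2 f) k‖) ^ (2 : ℝ) := by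
    refine Summable.congr f.2 fun k => ?_
    rw [Real.rpow_two, mul_pow]; rfl
  have hw : Summable fun k : Fin d → ℤ => (mixWeight s r k)⁻¹ ^ (2 : ℝ) := by
    simpa only [Real.rpow_two] using summable_mixWeight d hr hs
  have hpq : (2 : ℝ).HolderConjugate 2 := ⟨by norm_num, by norm_num, by norm_num⟩
  have key := Real.summable_and_inner_le_Lp_mul_Lq_tsum_of_nonneg hpq
    (fun k : Fin d → ℤ => (inv_pos.2 (mixWeight_pos s r k)).le)
    (fun k => mul_nonneg (mixWeight_pos s r k).le (norm_nonneg _)) hw hf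
  have e : ∀ k : Fin d → ℤ, (mixWeight s r k)⁻¹ *
      (mixWeight s r k * ‖mFourierCoeff (SobolevMix.toL2 f) k‖) =
        ‖mFourierCoeff (SobolevMix.toL2 f) k‖ := fun k =>
    inv_mul_cancel_left₀ (mixWeight_pos s r k).ne' _
  simp only [e, Real.rpow_two, mul_pow, ← Real.sqrt_eq_rpow] at key
  rw [SobolevMix.norm_eq]
  exact key

theorem SobolevMix.ae_bound {d : ℕ} {s r : ℝ} (hr : 0 < r) (hs : 1 / 2 < s)
    (f : SobolevMix d s r) :
    ∀ᵐ x ∂(volume : Measure (Torus d)), ‖SobolevMix.toL2 f x‖ ≤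
      √(∑' k : Fin d → ℤ, (mixWeight s r k)⁻¹ ^ 2) * ‖f‖ := by
  obtain ⟨h1, h2⟩ := SobolevMix.summable_coeff hr hs f
  set c : (Fin d → ℤ) → ℂ := fun k => mFourierCoeff (SobolevMix.toL2 f) k with hc
  have hn : ∀ k, ‖c k • mFourier k‖ = ‖c k‖ := fun k => by
    rw [norm_smul, mFourier_norm, mul_one]
  have hs' : Summable fun k => ‖c k • mFourier k‖ := by simpa only [hn] using h1
  have hg := hs'.of_norm.hasSum
  have hL := (ContinuousMap.toLp (E := ℂ) 2 (volume : Measure (Torus d)) ℂ).hasSum hg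
  have hu := hL.unique (by
    simpa only [map_smul] using hasSum_mFourier_series_L2 (SobolevMix.toL2 f))
  have hae := ContinuousMap.coeFn_toLp (p := 2) (𝕜 := ℂ) (volume : Measure (Torus d))
    (∑' k, c k • mFourier k)
  rw [hu] at hae
  filter_upwards [hae] with x hx
  rw [hx]
  refine ((ContinuousMap.norm_coe_le_norm _ x).trans (norm_tsum_le_tsum_norm hs')).trans ?_
  simpa only [hn] using h2

/-- The embedding `I_d : H^{s,r}_mix → L_∞`, `f ↦ f`, for `s > 1/2`. The class of functions modulo
equality almost everywhere is unchanged. -/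
noncomputable def embMixLinfty (d : ℕ) {s r : ℝ} (hr : 0 < r) (hs : 1 / 2 < s) :
    SobolevMix d s r →L[ℂ] TorusLp d ∞ :=
  LinearMap.mkContinuous
    { toFun := fun f => ⟨(SobolevMix.toL2 f : Torus d →ₘ[volume] ℂ), by
        rw [Lp.mem_Lp_iff_memLp]
        exact memLp_top_of_bound (Lp.aestronglyMeasurable _) _ (SobolevMix.ae_bound hr hs f)⟩
      map_add' := fun _ _ => rfl
      map_smul' := fun _ _ => rfl }
    (√(∑' k : Fin d → ℤ, (mixWeight s r k)⁻¹ ^ 2)) (fun f => by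
      rw [Lp.norm_def, eLpNorm_exponent_top]
      refine ENNReal.toReal_le_of_le_ofReal (by positivity) ?_
      exact eLpNormEssSup_le_of_ae_bound (SobolevMix.ae_bound hr hs f))

theorem embMixLinfty_ae (d : ℕ) {s r : ℝ} (hr : 0 < r) (hs : 1 / 2 < s) (f : SobolevMix d s r) :
    ⇑(embMixLinfty d hr hs f) =ᵐ[volume] ⇑(SobolevMix.toL2 f) :=
  Filter.EventuallyEq.rfl

/-! The characters are orthonormal in `L_2` and have modulus one everywhere. This makes the square
of the `n`-th approximation number a tail `∑_{j ≥ n} σ_j ^ 2`, where the `σ_j` are the numbers `1 /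
mixWeight s 2 k` in decreasing order. The proof establishes the two inequalities separately and
estimates the tail by counting lattice points.

Upper inequality (`SobolevMix.approxNumber_embMixLinfty_le`): keep the `n - 1` frequencies of
smallest weight; the sup norm of the remainder is at most the `ℓ_1` norm of its coefficients, and
Cauchy-Schwarz gives the tail.

Lower inequality (`SobolevMix.sum_Ico_le_norm_sub_sq`): an operator `A` of rank below `n` vanishes
on a large subspace `V` of trigonometric polynomials. For an orthonormal basis `u_i` of `V`, duality
at a point `x` gives `∑ |u_i x| ^ 2 ≤ ‖I_d - A‖ ^ 2`. Integration over `x` turns the left side into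
a trace, which is at least the tail.

Counting: `mixWeight s 2 = crossWeight ^ s`, and `crossWeight` is comparable, up to `√2 ^ d`, with
products defining hyperbolic crosses. Induction on the dimension counts their points
(`card_le_of_prod_one_add_abs_le`, `exists_finset_prod_abs_le`). For `j ≥ n` the `j`-th smallest
`crossWeight` therefore lies between `j / (C * (log j) ^ (d - 1))` and `j / (c * (log (2 * n)) ^ (d
- 1))`, and the sums of powers of `j` are compared with integrals. -/

/-! ### Counting lattice points in hyperbolic crosses -/

/-- Tangent bound for the convex function `t ^ (m + 1)` at the left end of an interval;
`add_pow_succ_le` uses the right end. They make sums of powers of logarithms telescope. -/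
theorem pow_succ_add_mul_le {u δ : ℝ} (hu : 0 ≤ u) (hδ : 0 ≤ δ) (m : ℕ) :
    u ^ (m + 1) + (m + 1) * u ^ m * δ ≤ (u + δ) ^ (m + 1) := by
  induction m with
  | zero => simp
  | succ m ih =>
    have h := mul_le_mul_of_nonneg_left ih (add_nonneg hu hδ)
    have h2 : 0 ≤ ((m : ℝ) + 1) * u ^ m * δ ^ 2 := by positivity
    calc u ^ (m + 1 + 1) + (((m + 1 : ℕ) : ℝ) + 1) * u ^ (m + 1) * δ
        ≤ (u + δ) * (u ^ (m + 1) + (m + 1) * u ^ m * δ) := by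
          push_cast
          linear_combination h2
      _ ≤ (u + δ) * (u + δ) ^ (m + 1) := h
      _ = _ := by ring

theorem add_pow_succ_le {v δ : ℝ} (hv : 0 ≤ v) (hδ : 0 ≤ δ) (m : ℕ) :
    (v + δ) ^ (m + 1) ≤ v ^ (m + 1) + (m + 1) * (v + δ) ^ m * δ := by
  induction m with
  | zero => simp
  | succ m ih =>
    have h := mul_le_mul_of_nonneg_left ih (add_nonneg hv hδ)
    have h2 : v ^ (m + 1) * δ ≤ (v + δ) ^ (m + 1) * δ := by
      gcongr; linarith
    calc (v + δ) ^ (m + 1 + 1) = (v + δ) * (v + δ) ^ (m + 1) := by ring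
      _ ≤ (v + δ) * (v ^ (m + 1) + (m + 1) * (v + δ) ^ m * δ) := h
      _ ≤ _ := by
          push_cast
          linear_combination h2

/-- The derivative of `-(2 * log (X / t) + m) ^ (m + 1)` is the summand with `t` in place of `i +
2`, so each term is at most an increment over `[i + 1, i + 2]`. The sum starts at `t = 2` because `1
+ |b| ≥ 2` for a nonzero integer `b`. -/
theorem sum_log_pow_le {X : ℝ} (m K : ℕ) (hK : (K : ℝ) + 1 ≤ X) :
    ∑ i ∈ Finset.range K,
        2 * ((m : ℝ) + 1) * (2 * Real.log (X / (i + 2)) + m) ^ m / (i + 2) ≤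
      (2 * Real.log X + m) ^ (m + 1) - (2 * Real.log (X / (K + 1)) + m) ^ (m + 1) := by
  induction K with
  | zero => simp
  | succ K ih =>
    push_cast at hK ⊢
    have hX : 0 < X := lt_of_lt_of_le (by positivity) hK
    rw [Finset.sum_range_succ]
    have ih' := ih (by linarith)
    set u := 2 * Real.log (X / (K + 1 + 1)) + m with hu
    have hu0 : 0 ≤ u := by
      have : 0 ≤ Real.log (X / (K + 1 + 1)) :=
        Real.log_nonneg (by rw [le_div_iff₀ (by positivity)]; linarith)
      positivity
    have hlog : 1 / ((K : ℝ) + 2) ≤ Real.log (X / (K + 1)) - Real.log (X / (K + 1 + 1)) := by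
      rw [← Real.log_div (by positivity) (by positivity)]
      have e : X / ((K : ℝ) + 1) / (X / (K + 1 + 1)) = (K + 2) / (K + 1) := by
        field_simp; ring
      rw [e]
      refine le_trans (le_of_eq ?_) (Real.one_sub_inv_le_log_of_pos (by positivity))
      field_simp; ring
    have h1 := pow_succ_add_mul_le hu0 (δ := 2 / ((K : ℝ) + 2)) (by positivity) m
    have h2 : (u + 2 / ((K : ℝ) + 2)) ^ (m + 1) ≤
        (2 * Real.log (X / (K + 1)) + m) ^ (m + 1) := by
      apply pow_le_pow_left₀ (by positivity)
      rw [hu]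
      have : 2 / ((K : ℝ) + 2) = 2 * (1 / ((K : ℝ) + 2)) := by ring
      rw [this]; linarith
    have e2 : 2 * ((m : ℝ) + 1) * (2 * Real.log (X / (K + 2)) + m) ^ m / (K + 2) =
        (m + 1) * u ^ m * (2 / ((K : ℝ) + 2)) := by
      rw [hu, show (K : ℝ) + 1 + 1 = K + 2 by ring]; ring
    rw [e2]
    linarith

theorem log_pow_le_sum {X : ℝ} (m K : ℕ) (hK : (K : ℝ) + 1 ≤ X) :
    (Real.log X) ^ (m + 1) - (Real.log (X / (K + 1))) ^ (m + 1) ≤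
    ∑ i ∈ Finset.range K, ((m : ℝ) + 1) * (Real.log (X / (i + 1))) ^ m / (i + 1) := by
  induction K with
  | zero => simp
  | succ K ih =>
    push_cast at hK ⊢
    have hX : 0 < X := lt_of_lt_of_le (by positivity) hK
    rw [Finset.sum_range_succ]
    have ih' := ih (by linarith)
    set v := Real.log (X / (K + 1 + 1)) with hv
    set u := Real.log (X / (K + 1)) with hu
    have hv0 : 0 ≤ v := Real.log_nonneg (by rw [le_div_iff₀ (by positivity)]; linarith)
    have hlog : u - v ≤ 1 / ((K : ℝ) + 1) := by
      rw [hu, hv, ← Real.log_div (by positivity) (by positivity)]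
      have e : X / ((K : ℝ) + 1) / (X / (K + 1 + 1)) = (K + 2) / (K + 1) := by
        field_simp; ring
      rw [e]
      refine le_trans (Real.log_le_sub_one_of_pos (by positivity)) (le_of_eq ?_)
      field_simp; ring
    have huv : v ≤ u := by
      apply Real.log_le_log (by positivity)
      gcongr; linarith
    have h1 := add_pow_succ_le hv0 (sub_nonneg.2 huv) m
    rw [add_sub_cancel] at h1
    have h2 : ((m : ℝ) + 1) * u ^ m * (u - v) ≤ (m + 1) * u ^ m * (1 / ((K : ℝ) + 1)) := by
      have : 0 ≤ u := hv0.trans huv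
      gcongr
    have e2 : ((m : ℝ) + 1) * u ^ m / (K + 1) = (m + 1) * u ^ m * (1 / ((K : ℝ) + 1)) := by ring
    rw [e2]
    linarith

/-- After telescoping up to `t = ⌊X⌋` there remains a power of `log (X / ⌊X⌋) ≤ 1 / ⌊X⌋`, which the
last summand absorbs. -/
theorem log_pow_le_sum_floor {X : ℝ} (hX : 1 ≤ X) (m : ℕ) :
    (Real.log X) ^ (m + 1) ≤
    ∑ i ∈ Finset.range ⌊X⌋₊, ((m : ℝ) + 1) * (Real.log (X / (i + 1))) ^ m / (i + 1) := by
  obtain ⟨K, hK⟩ : ∃ K, ⌊X⌋₊ = K + 1 :=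
    Nat.exists_eq_add_one.2 (Nat.floor_pos.2 hX)
  have h1 : (K : ℝ) + 1 ≤ X := by
    have := Nat.floor_le (zero_le_one.trans hX); rw [hK] at this; exact_mod_cast this
  have h2 : X < (K : ℝ) + 1 + 1 := by
    have := Nat.lt_floor_add_one X; rw [hK] at this; exact_mod_cast this
  rw [hK, Finset.sum_range_succ]
  have h := log_pow_le_sum m K h1
  set u := Real.log (X / (K + 1)) with hu
  have hu0 : 0 ≤ u := Real.log_nonneg (by rw [le_div_iff₀ (by positivity)]; linarith)
  have hu1 : u ≤ 1 / ((K : ℝ) + 1) := by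
    refine (Real.log_le_sub_one_of_pos (by positivity)).trans ?_
    rw [div_sub_one (by positivity)]
    gcongr; linarith
  have h3 : u ^ (m + 1) ≤ ((m : ℝ) + 1) * u ^ m / (K + 1) := by
    calc u ^ (m + 1) = u ^ m * u := pow_succ _ _
      _ ≤ u ^ m * (1 / ((K : ℝ) + 1)) := by gcongr
      _ ≤ ((m : ℝ) + 1) * (u ^ m * (1 / ((K : ℝ) + 1))) :=
          le_mul_of_one_le_left (by positivity) (by linarith [Nat.cast_nonneg (α := ℝ) m])
      _ = _ := by ring
  linarith

theorem sum_Icc_neg_natAbs (h : ℕ → ℝ) (K : ℕ) :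
    ∑ b ∈ Finset.Icc (-(K : ℤ)) K, h b.natAbs = h 0 + 2 * ∑ i ∈ Finset.range K, h (i + 1) := by
  have := Finset.sum_Icc_of_even_eq_range (f := fun b : ℤ => h b.natAbs) (fun b => by simp) K
  rw [this, Finset.sum_range_succ']
  simp only [Int.natAbs_natCast, Int.natAbs_zero, nsmul_eq_mul]
  push_cast
  ring

/-- Slice by the first coordinate `b`; each slice is a cross of size `X / (1 + |b|)`. With `z = 2 *
log X + m`, the slices `b ≠ 0` contribute a multiple of `z ^ (m + 1)` and the slice `b = 0` the same
multiple of `(m + 1) * z ^ m`. Bernoulli merges them into `(z + 1) ^ (m + 1)`, which is why the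
shift equals `m`. -/
theorem card_le_of_prod_one_add_abs_le (m : ℕ) {X : ℝ} (hX : 1 ≤ X)
    (S : Finset (Fin (m + 1) → ℤ)) (hS : ∀ k ∈ S, ∏ i, (1 + |(k i : ℝ)|) ≤ X) :
    (S.card : ℝ) ≤ 2 * X * (2 * Real.log X + m) ^ m / m ! := by
  induction m generalizing X with
  | zero =>
    set K := ⌊X - 1⌋₊ with hK
    have hKX : (K : ℝ) ≤ X - 1 := Nat.floor_le (by linarith)
    have hc : S.card ≤ (Finset.Icc (-(K : ℤ)) K).card := by
      refine Finset.card_le_card_of_injOn (fun k => k 0) ?_ ?_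
      · intro k hk
        have h := hS k hk
        rw [Fin.prod_univ_succ] at h
        have h' : ((k 0).natAbs : ℝ) ≤ X - 1 := by
          rw [Nat.cast_natAbs, Int.cast_abs]; simp at h ⊢; linarith
        have := Nat.le_floor h'
        simp only [Finset.coe_Icc, Set.mem_Icc]
        omega
      · intro k _ k' _ h
        funext i
        rw [show i = 0 from Fin.fin_one_eq_zero i]; exact h
    rw [Int.card_Icc] at hc
    have hc' : S.card ≤ 2 * K + 1 := by omega
    have : (S.card : ℝ) ≤ 2 * K + 1 := by exact_mod_cast hc'
    simp
    linarith
  | succ m ih =>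
    set K := ⌊X - 1⌋₊ with hK
    have hKX : (K : ℝ) ≤ X - 1 := Nat.floor_le (by linarith)
    have hX0 : 0 < X := by linarith
    have hone : ∀ k : Fin (m + 1) → ℤ, 1 ≤ ∏ i, (1 + |(k i : ℝ)|) := fun k =>
      Finset.prod_induction _ (fun x => 1 ≤ x)
        (fun a b ha hb => one_le_mul_of_one_le_of_one_le ha hb) le_rfl (fun i _ => by simp)
    set h : ℕ → ℝ := fun a =>
      2 * (X / (a + 1)) * (2 * Real.log (X / (a + 1)) + m) ^ m / m ! with hh
    have hmaps : ∀ k ∈ S, (1 + |(k 0 : ℝ)|) * ∏ i, (1 + |(Fin.tail k i : ℝ)|) ≤ X := by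
      intro k hk
      have := hS k hk
      rwa [Fin.prod_univ_succ] at this
    have hfib : S.card = ∑ b ∈ Finset.Icc (-(K : ℤ)) K, (S.filter fun k => k 0 = b).card := by
      refine Finset.card_eq_sum_card_fiberwise ?_
      intro k hk
      have h1 : 1 + |(k 0 : ℝ)| ≤ X :=
        le_trans (le_mul_of_one_le_right (by positivity) (hone _)) (hmaps k hk)
      have h' : ((k 0).natAbs : ℝ) ≤ X - 1 := by
        rw [Nat.cast_natAbs, Int.cast_abs]; linarith
      have := Nat.le_floor h'
      simp only [Finset.coe_Icc, Set.mem_Icc]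
      omega
    have hle : ∀ b ∈ Finset.Icc (-(K : ℤ)) K,
        (((S.filter fun k => k 0 = b).card : ℕ) : ℝ) ≤ h b.natAbs := by
      intro b hb
      have hbK : b.natAbs ≤ K := by rw [Finset.mem_Icc] at hb; omega
      have hbK' : (b.natAbs : ℝ) ≤ K := by exact_mod_cast hbK
      have hb1 : (b.natAbs : ℝ) = |(b : ℝ)| := by rw [Nat.cast_natAbs, Int.cast_abs]
      have hinj : ((S.filter fun k => k 0 = b).image Fin.tail).card =
          (S.filter fun k => k 0 = b).card := by
        refine Finset.card_image_of_injOn ?_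
        intro k hk k' hk' e
        simp only [Finset.coe_filter, Set.mem_ofPred_eq] at hk hk'
        rw [← Fin.cons_self_tail k, ← Fin.cons_self_tail k', hk.2, hk'.2, e]
      rw [← hinj, hh]
      refine ih ?_ _ ?_
      · rw [le_div_iff₀ (by positivity)]; linarith
      · intro k hk
        obtain ⟨k', hk', rfl⟩ := Finset.mem_image.1 hk
        rw [Finset.mem_filter] at hk'
        have := hmaps k' hk'.1
        rw [hk'.2] at this
        rw [le_div_iff₀ (by positivity), hb1]
        linarith
    have hsum : (S.card : ℝ) ≤ h 0 + 2 * ∑ i ∈ Finset.range K, h (i + 1) := by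
      rw [← sum_Icc_neg_natAbs, hfib, Nat.cast_sum]
      exact Finset.sum_le_sum hle
    have hlogs := sum_log_pow_le (X := X) m K (by linarith)
    have hlast : 0 ≤ (2 * Real.log (X / (K + 1)) + m) ^ (m + 1) := by
      have : 0 ≤ Real.log (X / (K + 1)) :=
        Real.log_nonneg (by rw [le_div_iff₀ (by positivity)]; linarith)
      positivity
    set z := 2 * Real.log X + m with hz
    have hz0 : 0 ≤ z := by have := Real.log_nonneg hX; positivity
    have hsum2 : 2 * ∑ i ∈ Finset.range K, h (i + 1) =
        2 * X / (m + 1)! * ∑ i ∈ Finset.range K,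
          2 * ((m : ℝ) + 1) * (2 * Real.log (X / (i + 2)) + m) ^ m / (i + 2) := by
      rw [Finset.mul_sum, Finset.mul_sum]
      refine Finset.sum_congr rfl fun i _ => ?_
      rw [hh, Nat.factorial_succ]
      push_cast
      rw [show (i : ℝ) + 1 + 1 = i + 2 by ring]
      field_simp
    have hh0 : h 0 = 2 * X / (m + 1)! * ((m + 1) * z ^ m) := by
      rw [hh, Nat.factorial_succ]; push_cast; rw [hz]; simp; field_simp
    have hfin := pow_succ_add_mul_le hz0 zero_le_one m
    calc (S.card : ℝ) ≤ 2 * X / (m + 1)! * ((m + 1) * z ^ m) + 2 * X / (m + 1)! * z ^ (m + 1) := by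
          refine hsum.trans ?_
          rw [hsum2, hh0]
          gcongr
          linarith
      _ = 2 * X / (m + 1)! * (z ^ (m + 1) + (m + 1) * z ^ m * 1) := by ring
      _ ≤ 2 * X / (m + 1)! * (z + 1) ^ (m + 1) := by gcongr
      _ = _ := by rw [hz]; push_cast; ring

/-- Same slicing, with all coordinates nonzero, so no shift arises. In dimension one `2 * ⌊X⌋ ≥ X`
is all that is kept, hence `2 ^ m` and not `2 ^ (m + 1)`. -/
theorem exists_finset_prod_abs_le (m : ℕ) {X : ℝ} (hX : 1 ≤ X) :
    ∃ S : Finset (Fin (m + 1) → ℤ), (∀ k ∈ S, (∀ i, k i ≠ 0) ∧ ∏ i, |(k i : ℝ)| ≤ X) ∧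
      2 ^ m * X * Real.log X ^ m / m ! ≤ (S.card : ℝ) := by
  induction m generalizing X with
  | zero =>
    set K := ⌊X⌋₊ with hK
    have hKX : (K : ℝ) ≤ X := Nat.floor_le (by linarith)
    refine ⟨((Finset.Icc (-(K : ℤ)) K).erase 0).image fun b _ => b, ?_, ?_⟩
    · intro k hk
      obtain ⟨b, hb, rfl⟩ := Finset.mem_image.1 hk
      rw [Finset.mem_erase, Finset.mem_Icc] at hb
      refine ⟨fun _ => hb.1, ?_⟩
      have : |b| ≤ K := abs_le.2 hb.2
      have : |(b : ℝ)| ≤ K := by exact_mod_cast this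
      simp
      linarith
    · rw [Finset.card_image_of_injective _ fun b b' h => congrFun h 0,
        Finset.card_erase_of_mem (by simp), Int.card_Icc]
      have h1 : 1 ≤ K := Nat.floor_pos.2 hX
      have h2 : ((K : ℤ) + 1 - -(K : ℤ)).toNat - 1 = 2 * K := by omega
      have h3 := Nat.lt_floor_add_one X
      have h4 : (1 : ℝ) ≤ K := by exact_mod_cast h1
      rw [h2]
      simp
      rw [← hK] at h3
      linarith
  | succ m ih =>
    set K := ⌊X⌋₊ with hK
    have hKX : (K : ℝ) ≤ X := Nat.floor_le (by linarith)
    have hX0 : 0 < X := by linarith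
    choose! T hT1 hT2 using fun Y hY => ih (X := Y) hY
    set B := (Finset.Icc (-(K : ℤ)) K).erase 0 with hB
    have hBa : ∀ b ∈ B, 0 < |(b : ℝ)| ∧ |(b : ℝ)| ≤ X := by
      intro b hb
      rw [hB, Finset.mem_erase, Finset.mem_Icc] at hb
      have : |b| ≤ K := abs_le.2 hb.2
      have : |(b : ℝ)| ≤ K := by exact_mod_cast this
      exact ⟨abs_pos.2 (by exact_mod_cast hb.1), by linarith⟩
    refine ⟨(B.sigma fun b => T (X / |(b : ℝ)|)).image fun q => Fin.cons q.1 q.2, ?_, ?_⟩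
    · intro k hk
      obtain ⟨⟨b, k'⟩, hb, rfl⟩ := Finset.mem_image.1 hk
      rw [Finset.mem_sigma] at hb
      obtain ⟨hb1, hb2⟩ := hb
      have h1 := hBa b hb1
      obtain ⟨h2, h3⟩ := hT1 _ (by rw [le_div_iff₀ h1.1]; simpa using h1.2) k' hb2
      refine ⟨?_, ?_⟩
      · refine Fin.cases ?_ ?_
        · simpa using abs_pos.1 h1.1
        · simpa using h2
      · rw [Fin.prod_univ_succ]
        simp only [Fin.cons_zero, Fin.cons_succ]
        rw [le_div_iff₀ h1.1] at h3
        linarith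
    · rw [Finset.card_image_of_injective, Finset.card_sigma]
      swap
      · rintro ⟨b, k⟩ ⟨b', k'⟩ h
        obtain ⟨rfl, rfl⟩ := Fin.cons_inj.1 h
        rfl
      set h : ℕ → ℝ := fun a =>
        2 ^ m * (X / a) * Real.log (X / a) ^ m / m ! with hh
      have hsum : ∑ b ∈ B, h b.natAbs = 2 * ∑ i ∈ Finset.range K, h (i + 1) := by
        have h0 := sum_Icc_neg_natAbs h K
        rw [← Finset.add_sum_erase _ _ (show (0 : ℤ) ∈ Finset.Icc (-(K : ℤ)) K by simp)] at h0
        simp only [Int.natAbs_zero] at h0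
        linarith
      have hlog := log_pow_le_sum_floor hX m
      rw [Nat.cast_sum]
      calc _ = 2 ^ (m + 1) * X / (m + 1)! * Real.log X ^ (m + 1) := by ring
        _ ≤ 2 ^ (m + 1) * X / (m + 1)! * _ := mul_le_mul_of_nonneg_left hlog (by positivity)
        _ = 2 * ∑ i ∈ Finset.range K, h (i + 1) := by
            rw [Finset.mul_sum, Finset.mul_sum]
            refine Finset.sum_congr rfl fun i _ => ?_
            rw [hh, Nat.factorial_succ]
            push_cast
            field_simp
            ring
        _ = ∑ b ∈ B, h b.natAbs := hsum.symm
        _ ≤ _ := by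
            refine Finset.sum_le_sum fun b hb => ?_
            have h1 := hBa b hb
            have hb1 : (b.natAbs : ℝ) = |(b : ℝ)| := by rw [Nat.cast_natAbs, Int.cast_abs]
            rw [hh]
            simp only [hb1]
            exact hT2 _ (by rw [le_div_iff₀ h1.1]; simpa using h1.2)

/-! ### Counting and ordering frequencies by their mixed weight -/

/-- The weight `∏ j, (1 + k_j ^ 2) ^ (1 / 2)` of mixed smoothness one. -/
noncomputable def crossWeight {d : ℕ} (k : Fin d → ℤ) : ℝ := ∏ j, √(1 + (k j : ℝ) ^ 2)

theorem one_le_crossWeight {d : ℕ} (k : Fin d → ℤ) : 1 ≤ crossWeight k :=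
  Finset.prod_induction _ (fun x => 1 ≤ x)
    (fun a b ha hb => one_le_mul_of_one_le_of_one_le ha hb) le_rfl
    (fun i _ => by rw [Real.one_le_sqrt]; nlinarith [sq_nonneg (k i : ℝ)])

theorem crossWeight_pos {d : ℕ} (k : Fin d → ℤ) : 0 < crossWeight k :=
  one_pos.trans_le (one_le_crossWeight k)

theorem mixWeight_two_eq {d : ℕ} (s : ℝ) (k : Fin d → ℤ) :
    mixWeight s 2 k = crossWeight k ^ s := by
  rw [mixWeight, crossWeight, ← Real.finsetProd_rpow _ _ (fun i _ => Real.sqrt_nonneg _)]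
  refine Finset.prod_congr rfl fun i _ => ?_
  rw [Real.rpow_two, sq_abs, Real.sqrt_eq_rpow, ← Real.rpow_mul (by positivity)]
  congr 1
  ring

theorem inv_mixWeight_two_sq {d : ℕ} (s : ℝ) (k : Fin d → ℤ) :
    (mixWeight s 2 k)⁻¹ ^ 2 = crossWeight k ^ (-(2 * s)) := by
  rw [mixWeight_two_eq, ← Real.rpow_neg (crossWeight_pos k).le, ← Real.rpow_natCast,
    ← Real.rpow_mul (crossWeight_pos k).le]
  congr 1
  push_cast
  ring

/-- Factorwise `(1 + |a|) ^ 2 ≤ 2 * (1 + a ^ 2)`. The companion `crossWeight_le_prod_abs` rests on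
`1 + a ^ 2 ≤ 2 * a ^ 2` for nonzero integers. -/
theorem prod_one_add_abs_le {d : ℕ} (k : Fin d → ℤ) :
    ∏ i, (1 + |(k i : ℝ)|) ≤ √2 ^ d * crossWeight k := by
  have : √2 ^ d * crossWeight k = ∏ i, √2 * √(1 + (k i : ℝ) ^ 2) := by
    rw [Finset.prod_mul_distrib]; simp [crossWeight]
  rw [this]
  refine Finset.prod_le_prod (fun i _ => by positivity) fun i _ => ?_
  rw [← Real.sqrt_mul (by norm_num)]
  apply Real.le_sqrt_of_sq_le
  nlinarith [sq_nonneg (1 - |(k i : ℝ)|), sq_abs (k i : ℝ)]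

theorem crossWeight_le_prod_abs {d : ℕ} (k : Fin d → ℤ) (hk : ∀ i, k i ≠ 0) :
    crossWeight k ≤ √2 ^ d * ∏ i, |(k i : ℝ)| := by
  have : √2 ^ d * ∏ i, |(k i : ℝ)| = ∏ i, √2 * |(k i : ℝ)| := by
    rw [Finset.prod_mul_distrib]; simp
  rw [this]
  refine Finset.prod_le_prod (fun i _ => by positivity) fun i _ => ?_
  rw [← Real.sqrt_sq_eq_abs, ← Real.sqrt_mul (by norm_num)]
  apply Real.sqrt_le_sqrt
  have : (1 : ℝ) ≤ (k i : ℝ) ^ 2 := by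
    have := sq_pos_of_ne_zero (hk i)
    exact_mod_cast this
  linarith

/-- Inverts the count: its bound contains `log X`, with `X = √2 ^ (m + 1) * R`, and this must be
replaced by `log x`. Since `m ! ≤ m ^ m ≤ (log x) ^ m`, the factor multiplying `X` in `hRx` is at
least one, so `X ≤ x`; then `2 * log X + m ≤ 3 * log x`. -/
theorem card_crossWeight_lt (m : ℕ) {x R : ℝ} (hx : 1 ≤ x) (hm : (m : ℝ) ≤ Real.log x)
    (hR : 1 ≤ R)
    (hRx : R * (2 * 3 ^ m * √2 ^ (m + 1) / m !) * Real.log x ^ m < x)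
    (S : Finset (Fin (m + 1) → ℤ)) (hS : ∀ k ∈ S, crossWeight k ≤ R) : (S.card : ℝ) < x := by
  set X := √2 ^ (m + 1) * R with hX
  have h2 : (1 : ℝ) ≤ √2 ^ (m + 1) := one_le_pow₀ (by rw [Real.one_le_sqrt]; norm_num)
  have hX1 : 1 ≤ X := one_le_mul_of_one_le_of_one_le h2 hR
  have hcard := card_le_of_prod_one_add_abs_le m hX1 S fun k hk =>
    (prod_one_add_abs_le k).trans (mul_le_mul_of_nonneg_left (hS k hk) (by positivity))
  have hy : 0 ≤ Real.log x := Real.log_nonneg hx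
  have hXx : X * (2 * 3 ^ m * Real.log x ^ m / m !) < x := by
    refine lt_of_eq_of_lt ?_ hRx
    rw [hX]; ring
  have hfac : (m ! : ℝ) ≤ Real.log x ^ m := by
    calc (m ! : ℝ) ≤ (m : ℝ) ^ m := by exact_mod_cast Nat.factorial_le_pow m
      _ ≤ _ := by gcongr
  have h3 : (1 : ℝ) ≤ 3 ^ m := one_le_pow₀ (by norm_num)
  have hone : 1 ≤ 2 * 3 ^ m * Real.log x ^ m / m ! := by
    rw [le_div_iff₀ (by positivity)]
    nlinarith [pow_nonneg hy m]
  have hXle : X ≤ x := (le_mul_of_one_le_right (by linarith) hone).trans hXx.le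
  have hlog : Real.log X ≤ Real.log x := Real.log_le_log (by linarith) hXle
  have hlog0 : 0 ≤ Real.log X := Real.log_nonneg hX1
  calc (S.card : ℝ) ≤ 2 * X * (2 * Real.log X + m) ^ m / m ! := hcard
    _ ≤ 2 * X * (3 * Real.log x) ^ m / m ! := by
        gcongr
        linarith
    _ = X * (2 * 3 ^ m * Real.log x ^ m / m !) := by rw [mul_pow]; ring
    _ < x := hXx

theorem finite_setOf_crossWeight_le {d : ℕ} (R : ℝ) :
    {k : Fin d → ℤ | crossWeight k ≤ R}.Finite := by
  have hsum := (summable_mixWeight d (r := 2) two_pos (s := 1) (by norm_num))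
  simp only [inv_mixWeight_two_sq] at hsum
  by_cases hR : 0 < R
  · have h := hsum.tendsto_cofinite_zero.eventually_lt_const
      (show (0 : ℝ) < R ^ (-(2 * 1) : ℝ) by positivity)
    refine h.subset fun k hk => ?_
    simp only [Set.mem_compl_iff, Set.mem_ofPred_eq, not_lt] at hk ⊢
    exact Real.rpow_le_rpow_of_nonpos (crossWeight_pos k) hk (by norm_num)
  · refine Set.finite_empty.subset fun k hk => ?_
    exact absurd ((crossWeight_pos k).trans_le hk) hR

/-- Order by `p`, breaking ties with an injection into `ℕ`; the rank of `k` is the number of its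
strict predecessors, so ranks start at zero. -/
theorem exists_rank {ι : Type*} [Countable ι] (p : ι → ℝ) (hp : ∀ R, {k | p k ≤ R}.Finite) :
    ∃ ρ : ι → ℕ, Function.Injective ρ ∧ ∀ k, ρ k + 1 ≤ {k' | p k' ≤ p k}.ncard := by
  obtain ⟨e, he⟩ := Countable.exists_injective_nat ι
  set below : ι → Set ι := fun k => {k' | p k' < p k ∨ (p k' = p k ∧ e k' < e k)} with hbelow
  have hsub : ∀ k, insert k (below k) ⊆ {k' | p k' ≤ p k} := by
    intro k k' hk'
    rcases hk' with rfl | h | h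
    · exact le_refl (p _)
    · exact le_of_lt h
    · exact le_of_eq h.1
  have hfin : ∀ k, (below k).Finite := fun k =>
    (hp (p k)).subset ((Set.subset_insert _ _).trans (hsub k))
  have hself : ∀ k, k ∉ below k := by
    rintro k (h | h)
    · exact lt_irrefl _ h
    · exact lt_irrefl _ h.2
  have hlt : ∀ k k', k ∈ below k' → (below k).ncard < (below k').ncard := by
    intro k k' h
    refine Set.ncard_lt_ncard ⟨?_, fun hss => hself k (hss h)⟩ (hfin k')
    intro l hl
    simp only [hbelow, Set.mem_ofPred_eq] at h hl ⊢
    rcases h with h | h <;> rcases hl with hl | hl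
    · exact Or.inl (hl.trans h)
    · exact Or.inl (hl.1 ▸ h)
    · exact Or.inl (h.1 ▸ hl)
    · exact Or.inr ⟨hl.1.trans h.1, hl.2.trans h.2⟩
  refine ⟨fun k => (below k).ncard, ?_, ?_⟩
  · intro k k' h
    by_contra hne
    have hcase : k ∈ below k' ∨ k' ∈ below k := by
      simp only [hbelow, Set.mem_ofPred_eq]
      have hee : e k ≠ e k' := fun h => hne (he h)
      rcases lt_trichotomy (p k) (p k') with h1 | h1 | h1
      · exact Or.inl (Or.inl h1)
      · rcases lt_or_gt_of_ne hee with h2 | h2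
        · exact Or.inl (Or.inr ⟨h1, h2⟩)
        · exact Or.inr (Or.inr ⟨h1.symm, h2⟩)
      · exact Or.inr (Or.inl h1)
    rcases hcase with h1 | h1
    · exact (hlt _ _ h1).ne h
    · exact (hlt _ _ h1).ne h.symm
  · intro k
    rw [← Set.ncard_insert_of_notMem (hself k) (hfin k)]
    exact Set.ncard_le_ncard (hsub k) (hp _)

theorem exists_finset_crossWeight_le (m : ℕ) {R : ℝ} (hR : √2 ^ (m + 1) ≤ R) :
    ∃ S : Finset (Fin (m + 1) → ℤ), (∀ k ∈ S, crossWeight k ≤ R) ∧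
      2 ^ m * (R / √2 ^ (m + 1)) * Real.log (R / √2 ^ (m + 1)) ^ m / m ! ≤ (S.card : ℝ) := by
  obtain ⟨S, h1, h2⟩ := exists_finset_prod_abs_le m (X := R / √2 ^ (m + 1))
    (by rwa [one_le_div₀ (by positivity)])
  refine ⟨S, fun k hk => (crossWeight_le_prod_abs k (h1 k hk).1).trans ?_, h2⟩
  have := (h1 k hk).2
  rw [le_div_iff₀ (by positivity)] at this
  linarith

theorem two_le_one_add_log_sqrt_twelve : 2 ≤ 1 + Real.log √12 := by
  have : 1 ≤ Real.log √12 := by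
    rw [Real.le_log_iff_exp_le (by positivity)]
    apply Real.le_sqrt_of_sq_le
    nlinarith [Real.exp_one_lt_d9, Real.exp_pos 1]
  linarith

/-- If `x ≥ e ^ y / 2`, then at least `x` frequencies have `crossWeight` at most
`x / (c * y ^ m)`, where `c = 5 / (6 * (m + 1)! * L ^ (m + 1))`. -/
theorem exists_finset_crossWeight_le_div (m : ℕ) {x y L c : ℝ} (hL : 2 ≤ L)
    (hy : 2 * ((m : ℝ) + 1) * L ≤ y) (hx : Real.exp y / 2 ≤ x)
    (hc : c = 5 / (6 * ((m + 1)! : ℝ) * L ^ (m + 1))) :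
    ∃ S : Finset (Fin (m + 1) → ℤ), (∀ k ∈ S, crossWeight k ≤ x / (c * y ^ m)) ∧
      x ≤ (S.card : ℝ) := by
  have hL0 : 0 < L := by linarith
  have hy4 : 4 ≤ y := by nlinarith [Nat.cast_nonneg (α := ℝ) m]
  have hy0 : 0 < y := by linarith
  have hc0 : 0 < c := by rw [hc]; positivity
  have hx0 : 0 < x := lt_of_lt_of_le (by positivity) hx
  -- A single term `(y / L) ^ (m + 1) / (m + 1)!` of the exponential series suffices; the surplus
  -- factor `y` and `y ≥ 4` give the `1 / 2`.
  have h1 : c * y ^ m ≤ 1 / 2 * Real.exp (y / L) := by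
    have h := Real.pow_div_factorial_le_exp (y / L) (by positivity) (m + 1)
    have e : c * y ^ m = 5 / (6 * y) * ((y / L) ^ (m + 1) / (m + 1)!) := by
      rw [hc, div_pow, pow_succ y]; field_simp
    rw [e]
    have h5 : 5 / (6 * y) ≤ 1 / 2 := by rw [div_le_div_iff₀ (by positivity) (by norm_num)]; linarith
    gcongr
  have h2 : √2 ^ (m + 1) ≤ Real.exp (y / (4 * L)) := by
    have h : √2 ≤ Real.exp (1 / 2) := by
      apply Real.sqrt_le_iff.2 ⟨by positivity, ?_⟩
      rw [← Real.exp_nat_mul]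
      norm_num
      linarith [Real.exp_one_gt_d9]
    calc √2 ^ (m + 1) ≤ Real.exp (1 / 2) ^ (m + 1) := by gcongr
      _ = Real.exp (((m : ℝ) + 1) / 2) := by rw [← Real.exp_nat_mul]; push_cast; ring_nf
      _ ≤ _ := by
        rw [Real.exp_le_exp, div_le_div_iff₀ (by norm_num) (by positivity)]
        linarith
  -- The exponents add up to `5 / (4 * L) ≤ 5 / 8` of `y` because `L ≥ 2`; the remaining `3 / 8`
  -- becomes the lower bound for the logarithm in the count.
  have h3 : c * y ^ m * √2 ^ (m + 1) * Real.exp (3 / 8 * y) ≤ x := by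
    calc c * y ^ m * √2 ^ (m + 1) * Real.exp (3 / 8 * y)
        ≤ 1 / 2 * Real.exp (y / L) * Real.exp (y / (4 * L)) * Real.exp (3 / 8 * y) := by gcongr
      _ = Real.exp (y * (5 / (4 * L) + 3 / 8)) / 2 := by
          rw [mul_assoc, mul_assoc, ← Real.exp_add, ← Real.exp_add]
          have : y / L + (y / (4 * L) + 3 / 8 * y) = y * (5 / (4 * L) + 3 / 8) := by
            field_simp; ring
          rw [this]; ring
      _ ≤ Real.exp y / 2 := by
          gcongr
          have : 5 / (4 * L) ≤ 5 / 8 := by gcongr; linarith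
          nlinarith
      _ ≤ x := hx
  have h4 : Real.exp (3 / 8 * y) ≤ x / (c * y ^ m) / √2 ^ (m + 1) := by
    rw [div_div, le_div_iff₀ (by positivity)]; linarith
  have hone : 1 ≤ Real.exp (3 / 8 * y) := Real.one_le_exp (by positivity)
  obtain ⟨S, hS1, hS2⟩ := exists_finset_crossWeight_le m (R := x / (c * y ^ m))
    ((one_le_div₀ (by positivity)).1 (hone.trans h4))
  refine ⟨S, hS1, le_trans ?_ hS2⟩
  have h5 : 3 / 8 * y ≤ Real.log (x / (c * y ^ m) / √2 ^ (m + 1)) := by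
    rwa [Real.le_log_iff_exp_le (by positivity)]
  have hs2 : √2 ^ 2 = 2 := Real.sq_sqrt (by norm_num)
  have hs14 : 1.4 ≤ √2 := Real.le_sqrt_of_sq_le (by norm_num)
  have hs15 : √2 ≤ 1.5 := Real.sqrt_le_iff.2 ⟨by norm_num, by norm_num⟩
  -- The inserted factor is the count divided by `x`, with `c` substituted; both of its parts are at
  -- least one since `L ≥ 2` and `2 * √2 * (3 / 8) > 1`.
  calc x ≤ x * ((6 / 5 * (m + 1) * L / √2) * (√2 * L * (3 / 8)) ^ m) := by
        apply le_mul_of_one_le_right hx0.le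
        apply one_le_mul_of_one_le_of_one_le
        · rw [one_le_div₀ (by positivity)]
          nlinarith [Nat.cast_nonneg (α := ℝ) m]
        · apply one_le_pow₀
          nlinarith
    _ = 2 ^ m * (x / (c * y ^ m) / √2 ^ (m + 1)) * (3 / 8 * y) ^ m / m ! := by
        have e : (2 : ℝ) ^ m = √2 ^ m * √2 ^ m := by rw [← mul_pow, ← pow_two, hs2]
        rw [hc, e, Nat.factorial_succ]
        push_cast
        simp only [mul_pow, pow_succ]
        field_simp
    _ ≤ _ := by gcongr

/-- Greedy choice: at stage `j` there are at least `j + 1` candidates and only `j` are already used.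
-/
theorem exists_injective_of_le_card {ι : Type*} (p : ι → ℝ) (b : ℕ → ℝ)
    (h : ∀ j : ℕ, ∃ S : Finset ι, (∀ k ∈ S, p k ≤ b j) ∧ j + 1 ≤ S.card) :
    ∃ f : ℕ → ι, Function.Injective f ∧ ∀ j, p (f j) ≤ b j := by
  classical
  have step : ∀ (j : ℕ) (g : Fin j → ι), ∃ k, p k ≤ b j ∧ ∀ i, g i ≠ k := by
    intro j g
    obtain ⟨S, hS, hc⟩ := h j
    have : ¬ S ⊆ Finset.univ.image g := by
      intro hss
      have := (Finset.card_le_card hss).trans Finset.card_image_le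
      simp at this
      omega
    obtain ⟨k, hk, hk'⟩ := Finset.not_subset.1 this
    exact ⟨k, hS k hk, fun i hi => hk' (Finset.mem_image.2 ⟨i, Finset.mem_univ _, hi⟩)⟩
  choose F hF1 hF2 using step
  let f : ℕ → ι := fun n => Nat.strongRec (fun j g => F j fun i => g i i.2) n
  have hf : ∀ j, f j = F j fun i => f i := by
    intro j
    simp only [f]
    rw [Nat.strongRec]
  refine ⟨f, ?_, fun j => by rw [hf]; exact hF1 _ _⟩
  have hne : ∀ i j, i < j → f i ≠ f j := by
    intro i j hij
    have := hF2 j (fun i => f i) ⟨i, hij⟩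
    rwa [← hf] at this
  intro i j hij
  by_contra hn
  rcases lt_or_gt_of_ne hn with h1 | h1
  · exact hne _ _ h1 hij
  · exact hne _ _ h1 hij.symm

/-! ### Power sums and their comparison with integrals -/

/-- Integral comparison for `t ^ (-(1 + b))` on `[x, x + 1]`, proved through `1 + z ≤ exp z` with `z
= b * log ((x + 1) / x)`; `sub_rpow_le_mul_rpow` is the opposite side. -/
theorem mul_rpow_le_sub_rpow {x b : ℝ} (hx : 0 < x) (hb : 0 ≤ b) :
    b * (x + 1) ^ (-(1 + b)) ≤ x ^ (-b) - (x + 1) ^ (-b) := by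
  have hx1 : 0 < x + 1 := by linarith
  have hlog : 1 / (x + 1) ≤ Real.log (x + 1) - Real.log x := by
    rw [← Real.log_div hx1.ne' hx.ne']
    refine le_trans (le_of_eq ?_) (Real.one_sub_inv_le_log_of_pos (by positivity))
    field_simp; ring
  have h1 : x ^ (-b) = (x + 1) ^ (-b) * Real.exp (b * (Real.log (x + 1) - Real.log x)) := by
    rw [Real.rpow_def_of_pos hx, Real.rpow_def_of_pos hx1, ← Real.exp_add]
    ring_nf
  have h2 : (x + 1) ^ (-(1 + b)) = (x + 1) ^ (-b) * (1 / (x + 1)) := by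
    rw [neg_add_rev, Real.rpow_add hx1, Real.rpow_neg_one, one_div]
  rw [h1, h2]
  have h3 := Real.add_one_le_exp (b * (Real.log (x + 1) - Real.log x))
  have h4 := mul_le_mul_of_nonneg_left hlog hb
  have h5 : 0 < (x + 1) ^ (-b) := by positivity
  nlinarith

theorem sub_rpow_le_mul_rpow {x a : ℝ} (hx : 0 < x) (ha : 0 ≤ a) :
    x ^ (-a) - (x + 1) ^ (-a) ≤ a * x ^ (-(1 + a)) := by
  have hx1 : 0 < x + 1 := by linarith
  have hlog : Real.log (x + 1) - Real.log x ≤ 1 / x := by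
    rw [← Real.log_div hx1.ne' hx.ne']
    refine le_trans (Real.log_le_sub_one_of_pos (by positivity)) (le_of_eq ?_)
    field_simp; ring
  have h1 : (x + 1) ^ (-a) = x ^ (-a) * Real.exp (-(a * (Real.log (x + 1) - Real.log x))) := by
    rw [Real.rpow_def_of_pos hx, Real.rpow_def_of_pos hx1, ← Real.exp_add]
    ring_nf
  have h2 : x ^ (-(1 + a)) = x ^ (-a) * (1 / x) := by
    rw [neg_add_rev, Real.rpow_add hx, Real.rpow_neg_one, one_div]
  rw [h1, h2]
  have h3 := Real.add_one_le_exp (-(a * (Real.log (x + 1) - Real.log x)))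
  have h4 := mul_le_mul_of_nonneg_left hlog ha
  have h5 : 0 < x ^ (-a) := by positivity
  nlinarith

theorem sum_Ico_rpow_le {n N : ℕ} (hn : 0 < n) {b : ℝ} (hb : 0 < b) :
    ∑ j ∈ Finset.Ico n N, (j : ℝ) ^ (-(1 + b)) ≤ (n : ℝ) ^ (-b) * (1 / n + 1 / b) := by
  have hn' : (0 : ℝ) < n := by exact_mod_cast hn
  have key : ∀ i : ℕ, ∑ j ∈ Finset.Ico n (n + i + 1), (j : ℝ) ^ (-(1 + b)) ≤
      (n : ℝ) ^ (-b) * (1 / n + 1 / b) - ((n + i : ℕ) : ℝ) ^ (-b) / b := by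
    intro i
    induction i with
    | zero =>
      simp only [add_zero, Nat.Ico_succ_singleton, Finset.sum_singleton]
      apply le_of_eq
      rw [neg_add_rev, Real.rpow_add hn', Real.rpow_neg_one]
      ring
    | succ i ih =>
      rw [← add_assoc, Finset.sum_Ico_succ_top (by omega)]
      have h := mul_rpow_le_sub_rpow (x := ((n + i : ℕ) : ℝ)) (by positivity) hb.le
      rw [← Nat.cast_succ, Nat.succ_eq_add_one] at h
      have h2 : ((n + i + 1 : ℕ) : ℝ) ^ (-(1 + b)) ≤
          (((n + i : ℕ) : ℝ) ^ (-b) - ((n + i + 1 : ℕ) : ℝ) ^ (-b)) / b := by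
        rw [le_div_iff₀ hb]; linarith
      rw [sub_div] at h2
      linarith
  calc ∑ j ∈ Finset.Ico n N, (j : ℝ) ^ (-(1 + b))
      ≤ ∑ j ∈ Finset.Ico n (n + N + 1), (j : ℝ) ^ (-(1 + b)) := by
        apply Finset.sum_le_sum_of_subset_of_nonneg
        · exact Finset.Ico_subset_Ico le_rfl (by omega)
        · intros; positivity
    _ ≤ _ := (key N).trans (sub_le_self _ (by positivity))

theorem rpow_sub_rpow_le_sum_Ico {n N : ℕ} (hn : 0 < n) (hN : n ≤ N) {a : ℝ} (ha : 0 < a) :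
    ((n : ℝ) ^ (-a) - (N : ℝ) ^ (-a)) / a ≤ ∑ j ∈ Finset.Ico n N, (j : ℝ) ^ (-(1 + a)) := by
  induction N, hN using Nat.le_induction with
  | base => simp
  | succ N hN ih =>
    rw [Finset.sum_Ico_succ_top hN]
    have hN0 : (0 : ℝ) < N := by exact_mod_cast hn.trans_le hN
    have h := sub_rpow_le_mul_rpow hN0 ha.le
    rw [div_le_iff₀ ha] at ih ⊢
    push_cast
    linarith

/-- The function `(log t) ^ α * t ^ (-β)` decreases once `α ≤ β * log t`. It allows the logarithms
in the tail to be frozen at `log n`. -/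
theorem log_rpow_mul_rpow_le {x y α β : ℝ} (hx : 1 < x) (hxy : x ≤ y) (hα : 0 ≤ α)
    (h : α ≤ β * Real.log x) :
    Real.log y ^ α * y ^ (-β) ≤ Real.log x ^ α * x ^ (-β) := by
  have hx0 : 0 < x := by linarith
  have hy0 : 0 < y := by linarith
  have hlx : 0 < Real.log x := Real.log_pos hx
  have hly : Real.log x ≤ Real.log y := Real.log_le_log hx0 hxy
  have h1 : Real.log y ^ α ≤ Real.log x ^ α * Real.exp (β * (Real.log y - Real.log x)) := by
    rw [Real.rpow_def_of_pos (hlx.trans_le hly), Real.rpow_def_of_pos hlx, ← Real.exp_add,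
      Real.exp_le_exp]
    have h2 := Real.log_le_sub_one_of_pos (div_pos (hlx.trans_le hly) hlx)
    rw [Real.log_div (hlx.trans_le hly).ne' hlx.ne', div_sub_one hlx.ne'] at h2
    have h3 : α * ((Real.log y - Real.log x) / Real.log x) ≤ β * (Real.log y - Real.log x) := by
      calc _ ≤ β * Real.log x * ((Real.log y - Real.log x) / Real.log x) :=
            mul_le_mul_of_nonneg_right h (div_nonneg (by linarith) hlx.le)
        _ = _ := by field_simp
    nlinarith
  calc Real.log y ^ α * y ^ (-β)
      ≤ Real.log x ^ α * Real.exp (β * (Real.log y - Real.log x)) * y ^ (-β) := by gcongr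
    _ = _ := by
        rw [Real.rpow_def_of_pos hy0, Real.rpow_def_of_pos hx0, mul_assoc, ← Real.exp_add]
        ring_nf

/-- The tail of the squared singular numbers beyond the `n - 1` largest ones. -/
theorem exists_finset_sum_crossWeight_rpow_le (m : ℕ) {s : ℝ} (hs : 1 / 2 < s) {n : ℕ}
    (hn2 : 2 ≤ n) (hnm : (m : ℝ) ≤ Real.log n) (hns : 4 * m * s / (2 * s - 1) ≤ Real.log n) :
    ∃ F : Finset (Fin (m + 1) → ℤ), F.card < n ∧
      ∀ S : Finset (Fin (m + 1) → ℤ), Disjoint S F →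
        ∑ k ∈ S, crossWeight k ^ (-(2 * s)) ≤
          2 / (2 * s - 1) * ((3 * √2) ^ (m + 1) / (m ! : ℝ)) ^ (2 * s) *
            (Real.log n ^ (2 * (m * s)) * (n : ℝ) ^ (-(2 * s - 1))) := by
  obtain ⟨ρ, hinj, hρ⟩ := exists_rank (crossWeight (d := m + 1)) finite_setOf_crossWeight_le
  have hFfin : {k | ρ k + 1 < n}.Finite := by
    refine Set.Finite.of_finite_image ((Set.finite_Iio n).subset ?_) hinj.injOn
    rintro _ ⟨k, hk, rfl⟩
    exact (Nat.lt_succ_self _).trans hk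
  have hn0 : 0 < n := by omega
  have hn1 : (1 : ℝ) < n := by exact_mod_cast hn2
  have hn2' : (2 : ℝ) ≤ n := by exact_mod_cast hn2
  have hb : 0 < s - 1 / 2 := by linarith
  -- Ranks start at zero, so `ρ k + 1 < n` selects at most `n - 1` frequencies.
  refine ⟨hFfin.toFinset, ?_, ?_⟩
  · have : (hFfin.toFinset.image ρ) ⊆ Finset.range (n - 1) := by
      intro j hj
      obtain ⟨k, hk, rfl⟩ := Finset.mem_image.1 hj
      rw [Set.Finite.mem_toFinset, Set.mem_ofPred_eq] at hk
      rw [Finset.mem_range]; omega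
    have h := Finset.card_le_card this
    rw [Finset.card_image_of_injective _ hinj, Finset.card_range] at h
    omega
  · intro S hS
    set C := 2 * 3 ^ m * √2 ^ (m + 1) / (m ! : ℝ) with hC
    have hC0 : 0 < C := by positivity
    set D := (3 * √2) ^ (m + 1) / (m ! : ℝ) with hD
    have hD0 : 0 < D := by positivity
    have hCD : C = 2 / 3 * D := by rw [hC, hD, mul_pow]; ring
    have hrank : ∀ k ∈ S, n ≤ ρ k + 1 := by
      intro k hk
      have := Finset.disjoint_left.1 hS hk
      rw [Set.Finite.mem_toFinset, Set.mem_ofPred_eq, not_lt] at this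
      exact this
    -- The decay `j ^ (-(2 * s))` is split: `j ^ (-(s - 1 / 2))` pays for freezing the logarithm at
    -- `n`, and the summable `j ^ (-(s + 1 / 2))` remains. This split produces the threshold `4 * m
    -- * s / (2 * s - 1)`.
    set g : ℕ → ℝ := fun j => C ^ (2 * s) * (Real.log n ^ (2 * (m * s)) *
      (n : ℝ) ^ (-(s - 1 / 2))) * (j : ℝ) ^ (-(1 + (s - 1 / 2))) with hg
    have hterm : ∀ k ∈ S, crossWeight k ^ (-(2 * s)) ≤ g (ρ k + 1) := by
      intro k hk
      have hj := hrank k hk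
      set j := ρ k + 1 with hjdef
      have hjn : (n : ℝ) ≤ j := by exact_mod_cast hj
      have hj1 : (1 : ℝ) < j := by linarith
      have hlj : 0 < Real.log j := Real.log_pos hj1
      have hlnj : Real.log n ≤ Real.log j := Real.log_le_log (by linarith) hjn
      -- Otherwise fewer than `j` frequencies would have weight at most `crossWeight k`,
      -- contradicting the rank of `k`.
      have hlow : (j : ℝ) ≤ crossWeight k * C * Real.log j ^ m := by
        by_contra! hlt
        have hfin := finite_setOf_crossWeight_le (d := m + 1) (crossWeight k)
        have h1 := card_crossWeight_lt m hj1.le (hnm.trans hlnj) (one_le_crossWeight k) hlt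
          hfin.toFinset
          (fun k' hk' => by simpa using hk')
        have h2 := hρ k
        rw [Set.ncard_eq_toFinset_card _ hfin] at h2
        have h3 : (j : ℝ) ≤ (hfin.toFinset.card : ℝ) := by exact_mod_cast h2
        linarith
      have hq : (j : ℝ) / (C * Real.log j ^ m) ≤ crossWeight k := by
        rw [div_le_iff₀ (by positivity)]; linarith
      have hmono := log_rpow_mul_rpow_le (α := 2 * (m * s)) (β := s - 1 / 2) hn1 hjn
        (by positivity) (by
          rw [div_le_iff₀ (by linarith)] at hns
          linarith)
      calc crossWeight k ^ (-(2 * s)) ≤ ((j : ℝ) / (C * Real.log j ^ m)) ^ (-(2 * s)) :=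
            Real.rpow_le_rpow_of_nonpos (by positivity) hq (by linarith)
        _ = C ^ (2 * s) * (Real.log j ^ (2 * (m * s)) * (j : ℝ) ^ (-(s - 1 / 2))) *
              (j : ℝ) ^ (-(1 + (s - 1 / 2))) := by
            rw [Real.rpow_neg (by positivity), ← Real.inv_rpow (by positivity), inv_div,
              Real.div_rpow (by positivity) (by positivity), Real.mul_rpow hC0.le (by positivity),
              ← Real.rpow_natCast, ← Real.rpow_mul hlj.le, mul_assoc, mul_assoc,
              ← Real.rpow_add (by linarith), div_eq_mul_inv, ← Real.rpow_neg (by linarith)]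
            ring_nf
        _ ≤ g j := mul_le_mul_of_nonneg_right
            (mul_le_mul_of_nonneg_left hmono (by positivity)) (by positivity)
    have hinj' : Function.Injective fun k => ρ k + 1 := (add_left_injective 1).comp hinj
    have hsub : S.image (fun k => ρ k + 1) ⊆
        Finset.Ico n ((S.image fun k => ρ k + 1).sup id + 1) := by
      intro j hj
      rw [Finset.mem_Ico]
      refine ⟨?_, Nat.lt_succ_of_le (Finset.le_sup (f := id) hj)⟩
      obtain ⟨k, hk, rfl⟩ := Finset.mem_image.1 hj
      exact hrank k hk
    have hln0 : 0 < Real.log n := Real.log_pos hn1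
    calc ∑ k ∈ S, crossWeight k ^ (-(2 * s)) ≤ ∑ k ∈ S, g (ρ k + 1) := Finset.sum_le_sum hterm
      _ = ∑ j ∈ S.image (fun k => ρ k + 1), g j :=
          (Finset.sum_image fun k _ k' _ h => hinj' h).symm
      _ ≤ ∑ j ∈ Finset.Ico n ((S.image fun k => ρ k + 1).sup id + 1), g j :=
          Finset.sum_le_sum_of_subset_of_nonneg hsub fun _ _ _ => by rw [hg]; positivity
      _ ≤ C ^ (2 * s) * (Real.log n ^ (2 * (m * s)) * (n : ℝ) ^ (-(s - 1 / 2))) *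
            ((n : ℝ) ^ (-(s - 1 / 2)) * (1 / n + 1 / (s - 1 / 2))) := by
          rw [hg, ← Finset.mul_sum]
          exact mul_le_mul_of_nonneg_left (sum_Ico_rpow_le hn0 hb) (by positivity)
      _ = ((2 / 3) ^ (2 * s) * (1 / n + 1 / (s - 1 / 2))) * D ^ (2 * s) *
            (Real.log n ^ (2 * (m * s)) * (n : ℝ) ^ (-(2 * s - 1))) := by
          rw [hCD, Real.mul_rpow (by norm_num) hD0.le,
            show -(2 * s - 1) = -(s - 1 / 2) + -(s - 1 / 2) by ring, Real.rpow_add (by linarith)]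
          ring
      _ ≤ _ := by
          gcongr
          -- The factor `(2 / 3) ^ (2 * s)` from `C = 2 / 3 * D` absorbs the extra `1 / n ≤ 1 / 2`
          -- left by the sum-integral comparison.
          have he : (3 / 2 : ℝ) ^ (2 * s) * (2 / 3) ^ (2 * s) = 1 := by
            rw [← Real.mul_rpow (by norm_num) (by norm_num)]; norm_num
          have h32 : 1 + s / 2 ≤ (3 / 2 : ℝ) ^ (2 * s) := by
            rw [Real.rpow_def_of_pos (by norm_num)]
            have h1 := Real.one_sub_inv_le_log_of_pos (show (0 : ℝ) < 3 / 2 by norm_num)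
            have h2 := Real.add_one_le_exp (Real.log (3 / 2) * (2 * s))
            norm_num at h1
            nlinarith
          have h4 : 1 / (n : ℝ) + 1 / (s - 1 / 2) ≤ (1 + s / 2) * (2 / (2 * s - 1)) := by
            have h5 : 1 / (n : ℝ) ≤ 1 / 2 := by gcongr
            have h6 : 1 / (s - 1 / 2) = 2 / (2 * s - 1) := by
              rw [div_eq_div_iff hb.ne' (by linarith)]; ring
            have h7 : 1 / 2 ≤ s / 2 * (2 / (2 * s - 1)) := by
              rw [div_mul_div_comm, div_le_div_iff₀ (by norm_num) (by linarith)]; linarith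
            rw [h6]; linarith
          have h8 : 0 ≤ 2 / (2 * s - 1) := div_nonneg (by norm_num) (by linarith)
          have h9 : (0 : ℝ) < (2 / 3) ^ (2 * s) := by positivity
          calc (2 / 3 : ℝ) ^ (2 * s) * (1 / n + 1 / (s - 1 / 2))
              ≤ (2 / 3) ^ (2 * s) * ((3 / 2) ^ (2 * s) * (2 / (2 * s - 1))) := by
                gcongr
                exact h4.trans (by gcongr)
            _ = ((3 / 2) ^ (2 * s) * (2 / 3) ^ (2 * s)) * (2 / (2 * s - 1)) := by ring
            _ = _ := by rw [he, one_mul]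

/-! ### Upper bound by truncating the Fourier series -/

theorem approxNumber_le {X Y : Type*} [NormedAddCommGroup X] [NormedSpace ℂ X]
    [NormedAddCommGroup Y] [NormedSpace ℂ Y] (T A : X →L[ℂ] Y) {n : ℕ}
    (hA : LinearMap.rank (A : X →ₗ[ℂ] Y) < (n : Cardinal)) {ε : ℝ} (h : ‖T - A‖ ≤ ε) :
    approxNumber T n ≤ ε := by
  refine le_trans (csInf_le ?_ ⟨A, hA, rfl⟩) h
  refine ⟨0, ?_⟩
  rintro _ ⟨B, _, rfl⟩
  exact norm_nonneg _

theorem le_approxNumber {X Y : Type*} [NormedAddCommGroup X] [NormedSpace ℂ X]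
    [NormedAddCommGroup Y] [NormedSpace ℂ Y] (T : X →L[ℂ] Y) {n : ℕ} (hn : 0 < n) {ε : ℝ}
    (h : ∀ A : X →L[ℂ] Y, LinearMap.rank (A : X →ₗ[ℂ] Y) < (n : Cardinal) → ε ≤ ‖T - A‖) :
    ε ≤ approxNumber T n := by
  -- The zero operator is admissible because `n > 0`; over an empty set the real `sInf` would be
  -- `0`.
  refine le_csInf ⟨_, 0, ?_, rfl⟩ ?_
  · have : ((0 : X →L[ℂ] Y) : X →ₗ[ℂ] Y) = 0 := rfl
    rw [this, LinearMap.rank_zero]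
    exact_mod_cast hn
  · rintro _ ⟨A, hA, rfl⟩
    exact h A hA

theorem mFourierCoeff_mFourierLp {d : ℕ} (k l : Fin d → ℤ) :
    mFourierCoeff (mFourierLp (d := Fin d) 2 k) l = if k = l then 1 else 0 := by
  rw [← mFourierBasis_repr, mFourierBasis.repr_apply_apply, coe_mFourierBasis]
  have := (orthonormal_iff_ite (𝕜 := ℂ)).1 (orthonormal_mFourier (d := Fin d)) l k
  rw [this]
  simp only [eq_comm]

namespace SobolevMix

variable {d : ℕ} {s r : ℝ}

/-- The trigonometric monomial as an element of `H^{s,r}_mix`. -/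
noncomputable def monomial (s r : ℝ) (k : Fin d → ℤ) : SobolevMix d s r :=
  ⟨mFourierLp 2 k, by
    refine summable_of_hasFiniteSupport ((Set.finite_singleton k).subset fun l hl => ?_)
    by_contra h
    apply hl
    have h' : k ≠ l := fun e => h e.symm
    show mixWeight s r l ^ 2 * ‖mFourierCoeff (mFourierLp (d := Fin d) 2 k) l‖ ^ 2 = 0
    rw [mFourierCoeff_mFourierLp, if_neg h']
    simp⟩

/-- The `k`-th Fourier coefficient as a linear functional. -/
noncomputable def coeff (s r : ℝ) (k : Fin d → ℤ) : SobolevMix d s r →ₗ[ℂ] ℂ where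
  toFun f := mFourierCoeff (toL2 f) k
  map_add' f g := by rw [map_add, torusCoeff_add]
  map_smul' c f := by rw [map_smul, torusCoeff_smul]; rfl

theorem coeff_monomial (k l : Fin d → ℤ) :
    coeff s r l (monomial s r k) = if k = l then 1 else 0 :=
  mFourierCoeff_mFourierLp k l

theorem norm_sq_eq (f : SobolevMix d s r) :
    ‖f‖ ^ 2 = ∑' k : Fin d → ℤ, mixWeight s r k ^ 2 * ‖coeff s r k f‖ ^ 2 := by
  rw [norm_eq, Real.sq_sqrt (tsum_nonneg fun k => by positivity)]
  rfl

theorem norm_coeff_le (k : Fin d → ℤ) (f : SobolevMix d s r) :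
    ‖coeff s r k f‖ ≤ (mixWeight s r k)⁻¹ * ‖f‖ := by
  have h : mixWeight s r k ^ 2 * ‖coeff s r k f‖ ^ 2 ≤ ‖f‖ ^ 2 := by
    rw [norm_sq_eq]
    exact Summable.le_tsum (f := fun k => mixWeight s r k ^ 2 * ‖coeff s r k f‖ ^ 2) f.2 k
      fun l _ => by positivity
  have hw := mixWeight_pos s r k
  rw [← mul_pow] at h
  have h2 := (sq_le_sq₀ (by positivity) (norm_nonneg f)).1 h
  rw [inv_mul_eq_div, le_div_iff₀ hw]
  linarith

/-- The `k`-th Fourier coefficient as a bounded linear functional. -/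
noncomputable def coeffCLM (s r : ℝ) (k : Fin d → ℤ) : SobolevMix d s r →L[ℂ] ℂ :=
  (coeff s r k).mkContinuous _ (norm_coeff_le k)

/-- The orthogonal projection onto the span of the monomials with frequencies in `F`. -/
noncomputable def proj (s r : ℝ) (F : Finset (Fin d → ℤ)) :
    SobolevMix d s r →L[ℂ] SobolevMix d s r :=
  ∑ k ∈ F, (coeffCLM s r k).smulRight (monomial s r k)

theorem proj_apply (F : Finset (Fin d → ℤ)) (f : SobolevMix d s r) :
    proj s r F f = ∑ k ∈ F, coeff s r k f • monomial s r k := by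
  simp [proj, coeffCLM]

theorem coeff_sub_proj (F : Finset (Fin d → ℤ)) (f : SobolevMix d s r) (l : Fin d → ℤ) :
    coeff s r l (f - proj s r F f) = if l ∈ F then 0 else coeff s r l f := by
  rw [map_sub, proj_apply, map_sum]
  simp only [map_smul, coeff_monomial, smul_eq_mul, mul_ite, mul_one, mul_zero,
    Finset.sum_ite_eq']
  split_ifs <;> simp

theorem rank_comp_proj_le {Y : Type*} [NormedAddCommGroup Y] [NormedSpace ℂ Y]
    (T : SobolevMix d s r →L[ℂ] Y) (F : Finset (Fin d → ℤ)) :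
    LinearMap.rank ((T.comp (proj s r F) : SobolevMix d s r →L[ℂ] Y) :
      SobolevMix d s r →ₗ[ℂ] Y) ≤ (F.card : Cardinal) := by
  classical
  set W := Submodule.span ℂ ((F.image fun k => T (monomial s r k) : Finset Y) : Set Y) with hW
  have hle : LinearMap.range ((T.comp (proj s r F) : SobolevMix d s r →L[ℂ] Y) :
      SobolevMix d s r →ₗ[ℂ] Y) ≤ W := by
    rintro _ ⟨f, rfl⟩
    have : (T.comp (proj s r F)) f = ∑ k ∈ F, coeff s r k f • T (monomial s r k) := by
      simp [proj_apply]
    rw [ContinuousLinearMap.coe_coe, this]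
    refine Submodule.sum_mem _ fun k hk => Submodule.smul_mem _ _ (Submodule.subset_span ?_)
    exact Finset.mem_coe.2 (Finset.mem_image_of_mem _ hk)
  calc _ ≤ Module.rank ℂ W := Submodule.rank_mono hle
    _ ≤ ((F.image fun k => T (monomial s r k)).card : Cardinal) := rank_span_finset_le _
    _ ≤ _ := by exact_mod_cast Finset.card_image_le

/-- The Fourier series converges absolutely in the uniform norm, and its sum is the `L_2` limit.
Keeping the `ℓ_1` norm here lets Cauchy-Schwarz be applied only to the frequencies outside a
truncation. -/
theorem norm_embMixLinfty_le (hr : 0 < r) (hs : 1 / 2 < s) (f : SobolevMix d s r) :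
    ‖embMixLinfty d hr hs f‖ ≤ ∑' k, ‖coeff s r k f‖ := by
  have h1 := (summable_coeff hr hs f).1
  set c : (Fin d → ℤ) → ℂ := fun k => mFourierCoeff (toL2 f) k with hc
  have hn : ∀ k, ‖c k • mFourier k‖ = ‖c k‖ := fun k => by
    rw [norm_smul, mFourier_norm, mul_one]
  have hs' : Summable fun k => ‖c k • mFourier k‖ := by simpa only [hn] using h1
  have hL := (ContinuousMap.toLp (E := ℂ) 2 (volume : Measure (Torus d)) ℂ).hasSum hs'.of_norm.hasSum
  have hu := hL.unique (by
    simpa only [map_smul] using hasSum_mFourier_series_L2 (toL2 f))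
  have hae := ContinuousMap.coeFn_toLp (p := 2) (𝕜 := ℂ) (volume : Measure (Torus d))
    (∑' k, c k • mFourier k)
  rw [hu] at hae
  have hb : ∀ᵐ x ∂(volume : Measure (Torus d)), ‖toL2 f x‖ ≤ ∑' k, ‖coeff s r k f‖ := by
    filter_upwards [hae] with x hx
    rw [hx]
    refine ((ContinuousMap.norm_coe_le_norm _ x).trans (norm_tsum_le_tsum_norm hs')).trans ?_
    exact le_of_eq (tsum_congr hn)
  rw [Lp.norm_def, eLpNorm_exponent_top]
  refine ENNReal.toReal_le_of_le_ofReal (tsum_nonneg fun k => norm_nonneg _) ?_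
  exact eLpNormEssSup_le_of_ae_bound hb

theorem approxNumber_embMixLinfty_le (hr : 0 < r) (hs : 1 / 2 < s) {n : ℕ} {B : ℝ}
    (F : Finset (Fin d → ℤ)) (hF : F.card < n) (hB0 : 0 ≤ B)
    (hB : ∀ S : Finset (Fin d → ℤ), Disjoint S F →
      ∑ k ∈ S, (mixWeight s r k)⁻¹ ^ 2 ≤ B ^ 2) :
    approxNumber (embMixLinfty d hr hs) n ≤ B := by
  classical
  refine approxNumber_le _ ((embMixLinfty d hr hs).comp (proj s r F))
    ((rank_comp_proj_le _ F).trans_lt (by exact_mod_cast hF)) ?_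
  refine ContinuousLinearMap.opNorm_le_bound _ hB0 fun f => ?_
  have e : (embMixLinfty d hr hs - (embMixLinfty d hr hs).comp (proj s r F)) f =
      embMixLinfty d hr hs (f - proj s r F f) := by
    rw [map_sub]; rfl
  rw [e]
  refine (norm_embMixLinfty_le hr hs _).trans ?_
  refine Real.tsum_le_of_sum_le (fun k => norm_nonneg _) fun S => ?_
  have hfil : ∑ k ∈ S, ‖coeff s r k (f - proj s r F f)‖ =
      ∑ k ∈ S \ F, (mixWeight s r k)⁻¹ * (mixWeight s r k * ‖coeff s r k f‖) := by
    rw [Finset.sdiff_eq_filter, Finset.sum_filter]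
    refine Finset.sum_congr rfl fun k _ => ?_
    rw [coeff_sub_proj, inv_mul_cancel_left₀ (mixWeight_pos s r k).ne']
    by_cases h : k ∈ F <;> simp [h]
  rw [hfil]
  refine (sq_le_sq₀ (Finset.sum_nonneg fun k _ => ?_) (by positivity)).1 ?_
  · have := mixWeight_pos s r k
    positivity
  have hcs := Finset.sum_mul_sq_le_sq_mul_sq (S \ F) (fun k => (mixWeight s r k)⁻¹)
    (fun k => mixWeight s r k * ‖coeff s r k f‖)
  refine hcs.trans ?_
  rw [mul_pow]
  gcongr
  · exact hB _ Finset.sdiff_disjoint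
  · rw [norm_sq_eq]
    simp only [mul_pow]
    exact Summable.sum_le_tsum _ (fun k _ => by positivity) f.2

end SobolevMix

/-! ### Lower bound by averaging over the kernel of a low-rank operator -/

/-- Bathtub principle: the weighted sum is least when the mass sits on the last indices. Termwise,
`β j - β a` and `t j - 1_{a ≤ j}` never have opposite signs. -/
theorem sum_Ico_le_sum_mul_of_antitone {β : ℕ → ℝ} (hβ : Antitone β) (hβ0 : ∀ j, 0 ≤ β j)
    {a M : ℕ} (ha : a ≤ M) (t : Fin M → ℝ) (ht0 : ∀ j, 0 ≤ t j) (ht1 : ∀ j, t j ≤ 1)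
    (ht : (M : ℝ) - a ≤ ∑ j, t j) :
    ∑ j ∈ Finset.Ico a M, β j ≤ ∑ j : Fin M, β j * t j := by
  have hterm : ∀ j : Fin M, (if a ≤ (j : ℕ) then β j else 0) +
      β a * (t j - if a ≤ (j : ℕ) then 1 else 0) ≤ β j * t j := by
    intro j
    split_ifs with h
    · nlinarith [hβ h, ht1 j]
    · nlinarith [hβ (not_le.1 h).le, ht0 j]
  have hind : ∀ γ : ℕ → ℝ, ∑ j : Fin M, (if a ≤ (j : ℕ) then γ j else 0) =
      ∑ j ∈ Finset.Ico a M, γ j := by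
    intro γ
    rw [Fin.sum_univ_eq_sum_range (fun j => if a ≤ j then γ j else 0) M, ← Finset.sum_filter]
    congr 1
    ext j
    simp only [Finset.mem_filter, Finset.mem_range, Finset.mem_Ico]
    tauto
  have hsum := Finset.sum_le_sum fun j (_ : j ∈ Finset.univ) => hterm j
  rw [Finset.sum_add_distrib, ← Finset.mul_sum, Finset.sum_sub_distrib, hind β,
    hind fun _ => 1] at hsum
  simp only [Finset.sum_const, Nat.card_Ico, nsmul_eq_mul, mul_one] at hsum
  rw [Nat.cast_sub ha] at hsum
  have := mul_nonneg (hβ0 a) (sub_nonneg.2 ht)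
  linarith

/-- The measure charges every nonempty open set, so the almost everywhere bound holds on a dense
closed set. Point evaluations of trigonometric polynomials are thus controlled. -/
theorem norm_apply_le_of_norm_toLp_top_le {d : ℕ} (g : C(Torus d, ℂ)) {f : TorusLp d ∞}
    (hf : ⇑f =ᵐ[volume] ⇑g) (x : Torus d) : ‖g x‖ ≤ ‖f‖ := by
  have hae : ∀ᵐ x ∂(volume : Measure (Torus d)), ‖g x‖ ≤ ‖f‖ := by
    filter_upwards [hf, ae_le_eLpNormEssSup (f := ⇑f) (μ := (volume : Measure (Torus d)))]
      with x hx hx2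
    rw [← hx, Lp.norm_def, eLpNorm_exponent_top, ← toReal_enorm]
    refine ENNReal.toReal_mono ?_ hx2
    rw [← eLpNorm_exponent_top]
    exact Lp.eLpNorm_ne_top f
  have hcl : IsClosed {x | ‖g x‖ ≤ ‖f‖} :=
    isClosed_le (by fun_prop) continuous_const
  have hd := Measure.dense_of_ae hae
  have := hcl.closure_eq ▸ hd.closure_eq
  have hm : x ∈ {x | ‖g x‖ ≤ ‖f‖} := by rw [this]; trivial
  exact hm

theorem integral_norm_sq_sum_mFourier {d : ℕ} {ι : Type*} [Fintype ι] {f : ι → Fin d → ℤ}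
    (hf : Function.Injective f) (c : ι → ℂ) :
    ∫ x : Torus d, ‖(∑ i, c i • mFourier (f i) : C(Torus d, ℂ)) x‖ ^ 2 = ∑ i, ‖c i‖ ^ 2 := by
  set g : C(Torus d, ℂ) := ∑ i, c i • mFourier (f i) with hg
  have h1 : inner ℂ (ContinuousMap.toLp (E := ℂ) 2 (volume : Measure (Torus d)) ℂ g)
      (ContinuousMap.toLp (E := ℂ) 2 (volume : Measure (Torus d)) ℂ g) =
        ((∫ x : Torus d, ‖g x‖ ^ 2 : ℝ) : ℂ) := by
    rw [ContinuousMap.inner_toLp, ← integral_complex_ofReal]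
    refine integral_congr_ae (Filter.Eventually.of_forall fun x => ?_)
    show g x * (starRingEnd ℂ) (g x) = _
    rw [Complex.mul_conj']
    push_cast
    rfl
  have h2 : ContinuousMap.toLp (E := ℂ) 2 (volume : Measure (Torus d)) ℂ g =
      ∑ i, c i • mFourierLp 2 (f i) := by
    rw [hg, map_sum]
    simp only [map_smul]
  have h4 : Orthonormal ℂ fun i => mFourierLp (d := Fin d) 2 (f i) :=
    orthonormal_mFourier.comp f hf
  rw [h2, h4.inner_sum c c Finset.univ] at h1
  have h3 : ∀ i, (starRingEnd ℂ) (c i) * c i = ((‖c i‖ ^ 2 : ℝ) : ℂ) := fun i => by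
    rw [Complex.conj_mul']; push_cast; rfl
  simp only [h3] at h1
  exact_mod_cast h1.symm

/-- If a linear functional on a finite-dimensional inner product space is bounded by `ε`, then
so is the `ℓ_2` norm of its values on an orthonormal family. -/
theorem sum_norm_sq_le_of_bound {E ι : Type*} [NormedAddCommGroup E] [InnerProductSpace ℂ E]
    [Fintype ι] {u : ι → E} (hu : Orthonormal ℂ u) (l : E →ₗ[ℂ] ℂ) {ε : ℝ}
    (hl : ∀ v ∈ Submodule.span ℂ (Set.range u), ‖l v‖ ≤ ε * ‖v‖) :
    ∑ i, ‖l (u i)‖ ^ 2 ≤ ε ^ 2 := by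
  set Q := ∑ i, ‖l (u i)‖ ^ 2 with hQ
  have hQ0 : 0 ≤ Q := by positivity
  -- The Riesz representer of `l` on the span: both `l v` and `‖v‖ ^ 2` equal `Q`.
  set v : E := ∑ i, (starRingEnd ℂ) (l (u i)) • u i with hv
  have h1 : l v = (Q : ℂ) := by
    rw [hv, map_sum, hQ, Complex.ofReal_sum]
    refine Finset.sum_congr rfl fun i _ => ?_
    rw [map_smul, smul_eq_mul, Complex.conj_mul']
    push_cast; rfl
  have h2 : ‖v‖ ^ 2 = Q := by
    have h : inner ℂ v v = (Q : ℂ) := by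
      rw [hv, hu.inner_sum, hQ, Complex.ofReal_sum]
      refine Finset.sum_congr rfl fun i _ => ?_
      rw [Complex.conj_mul', RCLike.norm_conj]
      push_cast; rfl
    rw [inner_self_eq_norm_sq_to_K] at h
    exact Complex.ofReal_injective (by push_cast; exact h)
  have h3 := hl v (Submodule.sum_mem _ fun i _ => Submodule.smul_mem _ _
    (Submodule.subset_span (Set.mem_range_self i)))
  rw [h1, Complex.norm_of_nonneg hQ0] at h3
  by_contra! hlt
  have hv0 : 0 < ‖v‖ := by
    have : 0 < ‖v‖ ^ 2 := by rw [h2]; exact lt_of_le_of_lt (sq_nonneg ε) hlt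
    refine lt_of_le_of_ne (norm_nonneg v) fun h => ?_
    rw [← h] at this
    simp at this
  have h4 : ‖v‖ ≤ ε := by
    rw [← h2, pow_two] at h3
    exact le_of_mul_le_mul_right h3 hv0
  have : ‖v‖ ^ 2 ≤ ε ^ 2 := by gcongr
  linarith

namespace SobolevMix

variable {d : ℕ} {s r : ℝ}

/-- The isometry `e_i ↦ (mixWeight s r (f i))⁻¹ • monomial (f i)`. -/
noncomputable def ofEuclidean (s r : ℝ) {M : ℕ} (f : Fin M → Fin d → ℤ) :
    EuclideanSpace ℂ (Fin M) →ₗ[ℂ] SobolevMix d s r where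
  toFun v := ∑ i, ((mixWeight s r (f i))⁻¹ * v i : ℂ) • monomial s r (f i)
  map_add' v w := by
    simp only [PiLp.add_apply, mul_add, add_smul, Finset.sum_add_distrib]
  map_smul' c v := by
    simp only [PiLp.smul_apply, smul_eq_mul, Finset.smul_sum, smul_smul, RingHom.id_apply]
    refine Finset.sum_congr rfl fun i _ => ?_
    ring_nf

/-- The trigonometric polynomial with coefficients `(mixWeight s r (f i))⁻¹ * v i`. -/
noncomputable def trigPoly (s r : ℝ) {M : ℕ} (f : Fin M → Fin d → ℤ) :
    EuclideanSpace ℂ (Fin M) →ₗ[ℂ] C(Torus d, ℂ) where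
  toFun v := ∑ i, ((mixWeight s r (f i))⁻¹ * v i : ℂ) • mFourier (f i)
  map_add' v w := by
    refine (Finset.sum_congr rfl fun i _ => ?_).trans Finset.sum_add_distrib
    rw [PiLp.add_apply, mul_add]
    exact add_smul (R := ℂ) (M := C(Torus d, ℂ)) _ _ _
  map_smul' c v := by
    simp only [PiLp.smul_apply, smul_eq_mul, Finset.smul_sum, smul_smul, RingHom.id_apply]
    refine Finset.sum_congr rfl fun i _ => ?_
    ring_nf

theorem toL2_ofEuclidean {M : ℕ} (f : Fin M → Fin d → ℤ) (v : EuclideanSpace ℂ (Fin M)) :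
    toL2 (ofEuclidean s r f v) =
      ContinuousMap.toLp (E := ℂ) 2 (volume : Measure (Torus d)) ℂ (trigPoly s r f v) := by
  simp only [ofEuclidean, trigPoly, LinearMap.coe_mk, AddHom.coe_mk, map_sum, map_smul]
  rfl

theorem norm_ofEuclidean {M : ℕ} {f : Fin M → Fin d → ℤ} (hf : Function.Injective f)
    (v : EuclideanSpace ℂ (Fin M)) : ‖ofEuclidean s r f v‖ = ‖v‖ := by
  classical
  have hcoeff : ∀ l, coeff s r l (ofEuclidean s r f v) =
      ∑ i, if f i = l then ((mixWeight s r (f i))⁻¹ * v i : ℂ) else 0 := by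
    intro l
    simp only [ofEuclidean, LinearMap.coe_mk, AddHom.coe_mk, map_sum, map_smul, coeff_monomial,
      smul_eq_mul, mul_ite, mul_one, mul_zero]
  rw [← sq_eq_sq₀ (norm_nonneg _) (norm_nonneg _), norm_sq_eq, EuclideanSpace.norm_sq_eq,
    tsum_eq_sum (s := Finset.univ.image f), Finset.sum_image fun i _ j _ h => hf h]
  · refine Finset.sum_congr rfl fun i _ => ?_
    have hw := mixWeight_pos s r (f i)
    rw [hcoeff, ← mul_pow]
    simp only [hf.eq_iff, Finset.sum_ite_eq', Finset.mem_univ, if_true, norm_mul,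
      Complex.norm_of_nonneg (inv_nonneg.2 hw.le)]
    rw [mul_inv_cancel_left₀ hw.ne']
  · intro l hl
    rw [hcoeff, Finset.sum_eq_zero]
    · simp
    · intro i _
      rw [if_neg fun h => hl (Finset.mem_image.2 ⟨i, Finset.mem_univ _, h⟩)]

theorem integral_norm_sq_trigPoly {M : ℕ} {f : Fin M → Fin d → ℤ} (hf : Function.Injective f)
    (v : EuclideanSpace ℂ (Fin M)) :
    ∫ x : Torus d, ‖trigPoly s r f v x‖ ^ 2 =
      ∑ i, (mixWeight s r (f i))⁻¹ ^ 2 * ‖v i‖ ^ 2 := by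
  refine (integral_norm_sq_sum_mFourier hf _).trans ?_
  refine Finset.sum_congr rfl fun i _ => ?_
  rw [norm_mul, Complex.norm_of_nonneg (inv_nonneg.2 (mixWeight_pos s r (f i)).le), mul_pow]

/-- On `V`, the kernel of `A` pulled back to `M` normalized monomials, `A` contributes nothing, so
evaluation at each `x` has norm at most `ε` there. Integrating `∑ |u_i x| ^ 2 ≤ ε ^ 2` gives the
weighted trace of the projection onto `V`. Only an antitone minorant `β` is needed, so `f` need not
list the frequencies by weight. -/
theorem sum_Ico_le_norm_sub_sq (hr : 0 < r) (hs : 1 / 2 < s) {n M : ℕ} (hn : 0 < n)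
    (hnM : n ≤ M + 1) {f : Fin M → Fin d → ℤ} (hf : Function.Injective f) {β : ℕ → ℝ}
    (hβ : Antitone β) (hβ0 : ∀ j, 0 ≤ β j) (hβf : ∀ j : Fin M, β j ≤ (mixWeight s r (f j))⁻¹ ^ 2)
    (A : SobolevMix d s r →L[ℂ] TorusLp d ∞)
    (hA : LinearMap.rank (A : SobolevMix d s r →ₗ[ℂ] TorusLp d ∞) < (n : Cardinal)) :
    ∑ j ∈ Finset.Ico (n - 1) M, β j ≤ ‖embMixLinfty d hr hs - A‖ ^ 2 := by
  set ε := ‖embMixLinfty d hr hs - A‖ with hε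
  set B : EuclideanSpace ℂ (Fin M) →ₗ[ℂ] TorusLp d ∞ :=
    (A : SobolevMix d s r →ₗ[ℂ] TorusLp d ∞).comp (ofEuclidean s r f) with hB
  set V := LinearMap.ker B with hV
  have hrank : Module.finrank ℂ (LinearMap.range B) < n := by
    have h1 : LinearMap.rank B < (n : Cardinal) :=
      (LinearMap.rank_comp_le_left _ _).trans_lt hA
    rw [LinearMap.rank, ← Module.finrank_eq_rank] at h1
    exact_mod_cast h1
  have hdim := LinearMap.finrank_range_add_finrank_ker B
  rw [finrank_euclideanSpace_fin, ← hV] at hdim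
  have hdimV : (M : ℝ) - (n - 1 : ℕ) ≤ Module.finrank ℂ V := by
    have : M ≤ Module.finrank ℂ V + (n - 1) := by omega
    have : (M : ℝ) ≤ Module.finrank ℂ V + (n - 1 : ℕ) := by exact_mod_cast this
    linarith
  set b := stdOrthonormalBasis ℂ V with hb
  set u : Fin (Module.finrank ℂ V) → EuclideanSpace ℂ (Fin M) := fun i => (b i : _) with hu
  have hortho : Orthonormal ℂ u := b.orthonormal.comp_linearIsometry V.subtypeₗᵢ
  have hspan : Submodule.span ℂ (Set.range u) ≤ V := by
    rw [Submodule.span_le]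
    rintro _ ⟨i, rfl⟩
    exact (b i).2
  have hpoint : ∀ x : Torus d, ∑ i, ‖trigPoly s r f (u i) x‖ ^ 2 ≤ ε ^ 2 := by
    intro x
    let l : EuclideanSpace ℂ (Fin M) →ₗ[ℂ] ℂ :=
      { toFun := fun v => trigPoly s r f v x
        map_add' := fun v w => by rw [map_add]; rfl
        map_smul' := fun c v => by rw [map_smul]; rfl }
    refine sum_norm_sq_le_of_bound hortho l fun v hv => ?_
    have hAv : A (ofEuclidean s r f v) = 0 := LinearMap.mem_ker.1 (hspan hv)
    have hae : ⇑(embMixLinfty d hr hs (ofEuclidean s r f v)) =ᵐ[volume]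
        ⇑(trigPoly s r f v) := by
      refine (embMixLinfty_ae d hr hs _).trans ?_
      rw [toL2_ofEuclidean]
      exact ContinuousMap.coeFn_toLp _ _
    refine (norm_apply_le_of_norm_toLp_top_le _ hae x).trans ?_
    have h := (embMixLinfty d hr hs - A).le_opNorm (ofEuclidean s r f v)
    rwa [sub_apply, hAv, sub_zero, norm_ofEuclidean hf] at h
  have hint : ∑ i, ∑ j, (mixWeight s r (f j))⁻¹ ^ 2 * ‖u i j‖ ^ 2 ≤ ε ^ 2 := by
    have hI : ∀ i, Integrable (fun x : Torus d => ‖trigPoly s r f (u i) x‖ ^ 2) volume := by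
      intro i
      exact (Continuous.integrable_of_hasCompactSupport (by fun_prop)
        (HasCompactSupport.of_compactSpace _))
    calc ∑ i, ∑ j, (mixWeight s r (f j))⁻¹ ^ 2 * ‖u i j‖ ^ 2
        = ∑ i, ∫ x : Torus d, ‖trigPoly s r f (u i) x‖ ^ 2 :=
          Finset.sum_congr rfl fun i _ => (integral_norm_sq_trigPoly hf _).symm
      _ = ∫ x : Torus d, ∑ i, ‖trigPoly s r f (u i) x‖ ^ 2 :=
          (integral_finsetSum _ fun i _ => hI i).symm
      _ ≤ ∫ _ : Torus d, ε ^ 2 :=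
          integral_mono (integrable_finsetSum _ fun i _ => hI i) (integrable_const _) hpoint
      _ = ε ^ 2 := by simp
  rw [Finset.sum_comm] at hint
  simp only [← Finset.mul_sum] at hint
  -- `∑ i, ‖u i j‖ ^ 2` is the squared length of the projection of the `j`-th unit vector onto `V`:
  -- at most one by Bessel, with total `dim V ≥ M - (n - 1)`.
  refine (sum_Ico_le_sum_mul_of_antitone hβ hβ0 (by omega) (fun j => ∑ i, ‖u i j‖ ^ 2)
    (fun j => by positivity) ?_ ?_).trans (le_trans ?_ hint)
  · intro j
    have h := hortho.sum_inner_products_le (s := Finset.univ)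
      (EuclideanSpace.single j (1 : ℂ))
    simpa [EuclideanSpace.inner_single_right] using h
  · rw [Finset.sum_comm]
    simp only [← EuclideanSpace.norm_sq_eq, hortho.1]
    simpa using hdimV
  · exact Finset.sum_le_sum fun j _ =>
      mul_le_mul_of_nonneg_right (hβf j) (by positivity)

end SobolevMix

/-! ### Both estimates with explicit constants -/

theorem sq_sqrt_mul_rpow_mul_div {q D l x e s b : ℝ} (hq : 0 ≤ q) (hD : 0 ≤ D) (hl : 0 ≤ l)
    (hx : 0 ≤ x) :
    (√q * D ^ s * (l ^ e / x ^ b)) ^ 2 = q * D ^ (2 * s) * (l ^ (2 * e) * x ^ (-(2 * b))) := by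
  have h : ∀ {z w : ℝ}, 0 ≤ z → (z ^ w) ^ 2 = z ^ (2 * w) := fun {z w} hz => by
    rw [← Real.rpow_natCast, ← Real.rpow_mul hz, mul_comm]; norm_num
  rw [mul_pow, mul_pow, div_pow, Real.sq_sqrt hq, h hD, h hl, h hx, Real.rpow_neg hx]
  rfl

theorem approxNumber_embMixLinfty_two_le (m : ℕ) {s : ℝ} (hs : 1 / 2 < s) {n : ℕ}
    (hn : max ((27 : ℝ) ^ (m + 1)) (Real.exp (4 * m * s / (2 * s - 1))) < n) :
    approxNumber (embMixLinfty (m + 1) (r := 2) two_pos hs) n ≤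
      √(2 / (2 * s - 1)) * ((3 * √2) ^ (m + 1) / (m ! : ℝ)) ^ s *
        (Real.log n ^ (m * s) / (n : ℝ) ^ (s - 1 / 2)) := by
  have hn27 : (27 : ℝ) ^ (m + 1) < n := (le_max_left _ _).trans_lt hn
  have hnexp : Real.exp (4 * m * s / (2 * s - 1)) < n := (le_max_right _ _).trans_lt hn
  have hn0 : (0 : ℝ) < n := (Real.exp_pos _).trans hnexp
  have h27 : (27 : ℝ) ≤ 27 ^ (m + 1) := le_self_pow₀ (by norm_num) (by omega)
  have hn2 : 2 ≤ n := by
    have : (2 : ℝ) ≤ n := by linarith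
    exact_mod_cast this
  have hlog : 0 ≤ Real.log n := Real.log_natCast_nonneg n
  have hnm : (m : ℝ) ≤ Real.log n := by
    rw [Real.le_log_iff_exp_le hn0]
    calc Real.exp m = Real.exp 1 ^ m := by rw [← Real.exp_nat_mul, mul_one]
      _ ≤ 27 ^ m := by
        gcongr
        linarith [Real.exp_one_lt_d9]
      _ ≤ 27 ^ (m + 1) := pow_le_pow_right₀ (by norm_num) (by omega)
      _ ≤ n := hn27.le
  have hns : 4 * m * s / (2 * s - 1) ≤ Real.log n := by
    rw [Real.le_log_iff_exp_le hn0]; exact hnexp.le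
  obtain ⟨F, hF, hB⟩ := exists_finset_sum_crossWeight_rpow_le m hs hn2 hnm hns
  refine SobolevMix.approxNumber_embMixLinfty_le two_pos hs F hF (by positivity) fun S hS => ?_
  simp only [inv_mixWeight_two_sq]
  refine (hB S hS).trans (le_of_eq ?_)
  rw [sq_sqrt_mul_rpow_mul_div (div_nonneg (by norm_num) (by linarith)) (by positivity) hlog
    hn0.le]
  congr 4
  ring

theorem le_approxNumber_embMixLinfty_two (m : ℕ) {s : ℝ} (hs : 1 / 2 < s) {n : ℕ}
    (hn : (12 * Real.exp 1 ^ 2) ^ (m + 1) < (n : ℝ)) :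
    √(1 / (4 * s - 2)) *
        (5 / (6 * ((m + 1)! : ℝ) * (1 + Real.log √12) ^ (m + 1))) ^ s *
        (Real.log (2 * n) ^ (m * s) / (n : ℝ) ^ (s - 1 / 2)) ≤
      approxNumber (embMixLinfty (m + 1) (r := 2) two_pos hs) n := by
  have hn0 : (0 : ℝ) < n := lt_trans (by positivity) hn
  have hnpos : 0 < n := by exact_mod_cast hn0
  have hL := two_le_one_add_log_sqrt_twelve
  set L := 1 + Real.log √12 with hLdef
  set y := Real.log (2 * n) with hydef
  -- The threshold is designed for this: `12 * e ^ 2 = exp (2 * L)`.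
  have hy : 2 * ((m : ℝ) + 1) * L ≤ y := by
    have h1 : Real.log ((12 * Real.exp 1 ^ 2) ^ (m + 1)) ≤ y :=
      Real.log_le_log (by positivity) (by linarith)
    refine le_trans (le_of_eq ?_) h1
    rw [Real.log_pow, Real.log_mul (by norm_num) (by positivity), Real.log_pow, Real.log_exp,
      hLdef, Real.log_sqrt (by norm_num)]
    push_cast
    ring
  have hy0 : 0 < y := lt_of_lt_of_le (by positivity) hy
  have hexp : Real.exp y / 2 = n := by rw [hydef, Real.exp_log (by positivity)]; ring
  set c := 5 / (6 * ((m + 1)! : ℝ) * L ^ (m + 1)) with hc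
  have hc0 : 0 < c := by positivity
  -- The maximum with `n = exp y / 2` makes the count applicable for every `j`. The index is
  -- zero-based, so it is inactive on the tail `j ≥ n - 1`.
  set b : ℕ → ℝ := fun j => max ((j : ℝ) + 1) n / (c * y ^ m) with hb
  have hb0 : ∀ j, 0 < b j := fun j => div_pos (lt_max_of_lt_right hn0) (by positivity)
  have hbmono : Monotone b := fun i j hij => by
    have : (i : ℝ) ≤ j := by exact_mod_cast hij
    simp only [hb]
    gcongr
  obtain ⟨f, hf, hfb⟩ := exists_injective_of_le_card (crossWeight (d := m + 1)) b fun j => by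
    obtain ⟨S, hS1, hS2⟩ := exists_finset_crossWeight_le_div m hL hy
      (x := max ((j : ℝ) + 1) n) (hexp.trans_le (le_max_right _ _)) hc
    refine ⟨S, hS1, ?_⟩
    have := (le_max_left _ _).trans hS2
    exact_mod_cast this
  have ha : 0 < 2 * s - 1 := by linarith
  -- With `M` this large the finite sum keeps at least half of the bound `n ^ (-(2 * s - 1)) / (2 *
  -- s - 1)`, whence the constant `1 / (4 * s - 2)`.
  obtain ⟨M, hM1, hM2⟩ : ∃ M : ℕ, ((M + 1 : ℕ) : ℝ) ^ (-(2 * s - 1)) <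
      (n : ℝ) ^ (-(2 * s - 1)) / 2 ∧ n ≤ M :=
    ((((tendsto_rpow_neg_atTop ha).comp tendsto_natCast_atTop_atTop).comp
      (Filter.tendsto_add_atTop_nat 1)).eventually_lt_const (by positivity)
      |>.and (Filter.eventually_ge_atTop n)).exists
  refine le_approxNumber _ hnpos fun A hA => ?_
  have key := SobolevMix.sum_Ico_le_norm_sub_sq two_pos hs hnpos (M := M) (by omega)
    (f := fun j => f j) (hf.comp Fin.val_injective) (β := fun j => b j ^ (-(2 * s)))
    (fun i j hij => Real.rpow_le_rpow_of_nonpos (hb0 i) (hbmono hij) (by linarith))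
    (fun j => (Real.rpow_pos_of_pos (hb0 j) _).le)
    (fun j => by
      rw [inv_mixWeight_two_sq]
      exact Real.rpow_le_rpow_of_nonpos (crossWeight_pos _) (hfb j) (by linarith))
    A hA
  refine (sq_le_sq₀ (by positivity) (norm_nonneg _)).1 (le_trans ?_ key)
  have hsum : ∑ j ∈ Finset.Ico (n - 1) M, b j ^ (-(2 * s)) =
      (c * y ^ m) ^ (2 * s) * ∑ j ∈ Finset.Ico n (M + 1), (j : ℝ) ^ (-(1 + (2 * s - 1))) := by
    have h1 := Finset.sum_Ico_add' (fun j : ℕ => (j : ℝ) ^ (-(1 + (2 * s - 1)))) (n - 1) M 1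
    rw [Nat.sub_add_cancel hnpos] at h1
    rw [← h1, Finset.mul_sum]
    refine Finset.sum_congr rfl fun j hj => ?_
    have hj' : (n : ℝ) ≤ (j : ℝ) + 1 := by
      rw [Finset.mem_Ico] at hj
      have : n ≤ j + 1 := by omega
      exact_mod_cast this
    simp only [hb]
    rw [max_eq_left hj', show -(1 + (2 * s - 1)) = -(2 * s) by ring,
      Real.div_rpow (by positivity) (by positivity), Real.rpow_neg (x := c * y ^ m) (by positivity),
      div_inv_eq_mul]
    push_cast
    ring
  rw [hsum, sq_sqrt_mul_rpow_mul_div (div_nonneg one_pos.le (by linarith)) hc0.le hy0.le hn0.le]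
  have hlow := rpow_sub_rpow_le_sum_Ico hnpos (N := M + 1) (by omega) ha
  have hhalf : (n : ℝ) ^ (-(2 * s - 1)) / 2 / (2 * s - 1) ≤
      ∑ j ∈ Finset.Ico n (M + 1), (j : ℝ) ^ (-(1 + (2 * s - 1))) := by
    refine le_trans ?_ hlow
    gcongr
    linarith
  refine le_trans (le_of_eq ?_) (mul_le_mul_of_nonneg_left hhalf (by positivity))
  rw [Real.mul_rpow hc0.le (by positivity), ← Real.rpow_natCast y m, ← Real.rpow_mul hy0.le,
    show 2 * (s - 1 / 2) = 2 * s - 1 by ring, show 4 * s - 2 = 2 * (2 * s - 1) by ring,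
    show (m : ℝ) * (2 * s) = 2 * (m * s) by ring]
  field_simp

theorem mainTheorem6 (d : ℕ) (hd : 1 ≤ d) (s : ℝ) (hs : 1 / 2 < s) :
    (∀ n : ℕ,
      max ((27 : ℝ) ^ d) (Real.exp (4 * ((d : ℝ) - 1) * s / (2 * s - 1))) < (n : ℝ) →
        approxNumber (embMixLinfty d (r := 2) two_pos hs) n ≤
          √(2 / (2 * s - 1)) * ((3 * √2) ^ d / ((d - 1)! : ℝ)) ^ s *
            (Real.log n ^ (((d : ℝ) - 1) * s) / (n : ℝ) ^ (s - 1 / 2))) ∧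
    (∀ n : ℕ,
      (12 * Real.exp 1 ^ 2) ^ d < (n : ℝ) →
        √(1 / (4 * s - 2)) *
            (5 / (6 * (d ! : ℝ) * (1 + Real.log √12) ^ d)) ^ s *
            (Real.log (2 * n) ^ (((d : ℝ) - 1) * s) / (n : ℝ) ^ (s - 1 / 2)) ≤
          approxNumber (embMixLinfty d (r := 2) two_pos hs) n) := by
  obtain ⟨m, rfl⟩ : ∃ m, d = m + 1 := ⟨d - 1, by omega⟩
  have hm : ((m + 1 : ℕ) : ℝ) - 1 = m := by push_cast; ring
  rw [hm, Nat.add_sub_cancel]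
  exact ⟨fun n hn => approxNumber_embMixLinfty_two_le m hs hn,
    fun n hn => le_approxNumber_embMixLinfty_two m hs hn⟩
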